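/- Let $k$ be a field. All quivers $Q=(Q_0,Q_1)$ below are finite; $[x,y]_Q$ denotes the number of arrows from $x$ to $y$. A *relation* over $Q$ is a $k$-linear combination of paths of length at least $2$ with a common start and a common end. With $J$ the ideal of $kQ$ generated by the arrows, an ideal $I$ of $kQ$ is *admissible* if $J^n\subseteq I\subseteq J^2$ for some $n\ge 2$. **Generalized bound path algebras.** Let $\Gamma$ be a quiver and, for each $i\in\Gamma_0$, let $A_i=k\Sigma_i/(\Omega_i)$, where $\Sigma_i$ is a quiver and $\Omega_i$ is a finite set of relations over $\Sigma_i$ generating an admissible ideal; put $\mathcal A=(A_i)_i$. The generalized path algebra $k(\Gamma,\mathcal A)$ is the space spanned by the $\mathcal A$-paths $a_1\beta_1a_2\cdots\beta_na_{n+1}$ ($n\ge 0$, $\beta_1\cdots\beta_n$ a path of $\Gamma$, each $a_j$ in the algebra at the corresponding vertex), modulo $k$-multilinearity in the $a_j$, with multiplication by concatenation, the adjacent entries $a_{n+1}b_1$ being multiplied, and zero if the ends do not match. Let $I$ be a finite set of relations over $\Gamma$ generating an admissible ideal, and let $\mathcal A(I)$ be the set of all elements $\sum_t\lambda_t\,\beta_{t1}\overline{\gamma_{t1}}\beta_{t2}\cdots\overline{\gamma_{t(m_t-1)}}\beta_{tm_t}$,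 where $\sum_t\lambda_t\beta_{t1}\cdots\beta_{tm_t}\in I$ (with pairwise distinct paths) and $\gamma_{tj}$ is any path of $\Sigma_{e(\beta_{tj})}$, $e(\beta)$ denoting the end of $\beta$. Then $k(\Gamma,\mathcal A,I)=k(\Gamma,\mathcal A)/(\mathcal A(I))$ is called a *gbp-algebra*. It is a *simplification* of an algebra $A$ if $A\cong k(\Gamma,\mathcal A,I)$ as $k$-algebras, and a simplification *without cycles* if moreover $\Gamma$ is acyclic. **Equivalence relations.** Let $\sim$ be an equivalence relation on $Q_0$. The reduced quiver $Q^\sim$ is obtained from $Q$ by deleting all arrows whose start and end are equivalent. The quotient quiver $Q^\sim/{\sim}$ has vertex set $Q_0/{\sim}$ and $\max\{[x,y]_{Q^\sim}:x\in a,\,y\in b\}$ arrows from $a$ to $b$. The relation $\sim$ is *coherent with the arrows* if (1) $i\sim j$ for each arrow $i\to j$ contained in an oriented cycle, and (2) $i\sim j$ and $j\nsim l$ imply $[i,l]_Q=[j,l]_Q$ and $[l,i]_Q=[l,j]_Q$. A *labelling* is a quiver morphism $z:Q^\sim\to Q^\sim/{\sim}$ with $z(x)=\overline x$ on vertices that is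 bijective from $Q^\sim(x,y)$ to $(Q^\sim/{\sim})(\overline x,\overline y)$ for all $x,y\in Q_0$. For a path $\gamma$ of $Q$, $z(\gamma)$ is the path obtained by dropping the arrows inside classes and applying $z$ to the others; $\gamma$ is *straightforward* if it has length zero or if both its first and its last arrow join non-equivalent vertices. Write a relation as $\rho=\sum_t\lambda_t\gamma_t$ with the $\gamma_t$ pairwise distinct paths and all $\lambda_t\ne0$. It is *internal* if every $z(\gamma_t)$ has length $0$; it is *external* if all $\gamma_t$ are straightforward and the $z(\gamma_t)$ are pairwise distinct. For a class $c$ let $\Sigma_c$ be the full subquiver of $Q$ on $c$. A finite set $R$ of relations over $Q$ is *compatible* with $\sim$ (relative to $z$) if (1) each $\rho\in R$ is internal or external; (2) for each class $c$ the relations in $R$ involving only vertices of $c$ generate an admissible ideal of $k\Sigma_c$; and (3) if $\rho=\sum_t\lambda_t\gamma_t\in R$ is external and $(\eta_t)_t$ are straightforward paths of $Q$ with a common start and a common end and $z(\eta_t)=z(\gamma_t)$ for all $t$, then $\sum_t\lambda_t\eta_t\in R$. **Theorem.** Let $A=kQ/(R)$, where $Q$ is a finite quiver and $R$ is a finite set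 of relations over $Q$ generating an admissible ideal. Let $\sim$ be an equivalence relation on $Q_0$ that is coherent with the arrows of $Q$, let $z$ be a labelling, and suppose that $R$ is compatible with $\sim$ relative to $z$. Put $\Gamma=Q^\sim/{\sim}$; for each class $c\in\Gamma_0$ let $\Omega_c$ be the set of the relations in $R$ involving only vertices of $c$ and $A_c=k\Sigma_c/(\Omega_c)$; put $\mathcal A=(A_c)_c$ and $I=\{z(\rho):\rho\in R\text{ external}\}$, where $z(\sum_t\lambda_t\gamma_t)=\sum_t\lambda_tz(\gamma_t)$. Then $A(\sim)=k(\Gamma,\mathcal A,I)$ is a gbp-algebra and is a simplification without cycles of $A$; that is, $\Gamma$ is acyclic, the $\Omega_c$ and $I$ are finite sets of relations generating admissible ideals, and $kQ/(R)\cong k(\Gamma,\mathcal A,I)$ as $k$-algebras. -/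

import Mathlib

namespace GenPathAlg

universe u v w u' v'

noncomputable section

/-! ## Algebras spanned by a composable family -/

/-- An associative and unital composition on a family `H a b` of "paths from `a` to `b`",
written in the order of juxtaposition. -/
class PathSystem {V : Type u} (H : V → V → Type v) where
  id : ∀ a, H a a
  comp : ∀ {a b c}, H a b → H b c → H a c
  id_comp : ∀ {a b} (p : H a b), comp (id a) p = p
  comp_id : ∀ {a b} (p : H a b), comp p (id b) = p
  assoc : ∀ {a b c d} (p : H a b) (q : H b c) (r : H c d),
    comp (comp p q) r = comp p (comp q r)

/-- An element of the family together with its start `src` and its end `tgt`. -/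
structure Mor {V : Type u} (H : V → V → Type v) where
  src : V
  tgt : V
  hom : H src tgt

/-- The `k`-vector space with basis the set of all elements of the family `H`. -/
def SpanAlg (k : Type w) [Field k] {V : Type u} (H : V → V → Type v) : Type (max u v w) :=
  Mor H →₀ k

namespace SpanAlg

variable {k : Type w} [Field k] {V : Type u} {H : V → V → Type v}

instance : AddCommGroup (SpanAlg k H) := inferInstanceAs (AddCommGroup (Mor H →₀ k))
instance : Module k (SpanAlg k H) := inferInstanceAs (Module k (Mor H →₀ k))

/-- The basis element given by `p`. -/
def of (p : Mor H) : SpanAlg k H := Finsupp.single p (1 : k)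

/-- The coefficient of `f` at the basis element `p`. -/
def coeff (f : SpanAlg k H) (p : Mor H) : k := (show Mor H →₀ k from f) p

/-- The finite set of basis elements which occur in `f` with a nonzero coefficient. -/
def supp (f : SpanAlg k H) : Finset (Mor H) := Finsupp.support (show Mor H →₀ k from f)

theorem induction {P : SpanAlg k H → Prop} (f : SpanAlg k H) (zero : P 0)
    (add : ∀ f g, P f → P g → P (f + g)) (of : ∀ (c : k) (p : Mor H), P (c • of p)) : P f :=
  Finsupp.induction_linear (motive := P) f zero add fun p c => by
    have h := of c p
    have e : (c • SpanAlg.of p : SpanAlg k H) = (Finsupp.single p c : Mor H →₀ k) :=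
      (Finsupp.smul_single c p (1 : k)).trans (by rw [smul_eq_mul, mul_one])
    rwa [e] at h

/-- The linear map which is given on the basis by `φ`. -/
def linExt {N : Type*} [AddCommGroup N] [Module k N] (φ : Mor H → N) : SpanAlg k H →ₗ[k] N :=
  (Finsupp.linearCombination k φ : (Mor H →₀ k) →ₗ[k] N)

theorem linExt_of {N : Type*} [AddCommGroup N] [Module k N] (φ : Mor H → N) (p : Mor H) :
    linExt (k := k) φ (of p) = φ p :=
  (Finsupp.linearCombination_single k (1 : k) p).trans (one_smul k _)

/-- The linear map which sends the basis element `p` to the basis element `φ p`. -/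
def map {V' : Type u'} {H' : V' → V' → Type v'} (φ : Mor H → Mor H') :
    SpanAlg k H →ₗ[k] SpanAlg k H' :=
  linExt fun p => of (φ p)

variable [PathSystem H]

open Classical in
/-- The product of two basis elements: the composition if the end of `p` is the start of `q`,
and zero otherwise. -/
def basisMul (p q : Mor H) : SpanAlg k H :=
  if h : p.tgt = q.src then of ⟨p.src, q.tgt, PathSystem.comp p.hom (h ▸ q.hom)⟩ else 0

/-- The bilinear extension of `basisMul`. -/
def mulLin : SpanAlg k H →ₗ[k] SpanAlg k H →ₗ[k] SpanAlg k H :=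
  linExt fun p => linExt fun q => basisMul p q

instance : Mul (SpanAlg k H) := ⟨fun f g => mulLin f g⟩

theorem mul_def (f g : SpanAlg k H) : f * g = mulLin f g := rfl

theorem of_mul_of (p q : Mor H) : (of p * of q : SpanAlg k H) = basisMul p q := by
  rw [mul_def, mulLin, linExt_of, linExt_of]

theorem of_mul_of_comp {a b c : V} (p : H a b) (q : H b c) :
    (of ⟨a, b, p⟩ * of ⟨b, c, q⟩ : SpanAlg k H) = of ⟨a, c, PathSystem.comp p q⟩ := by
  rw [of_mul_of, basisMul, dif_pos rfl]

theorem of_mul_of_ne {p q : Mor H} (h : p.tgt ≠ q.src) : (of p * of q : SpanAlg k H) = 0 := by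
  rw [of_mul_of, basisMul, dif_neg h]

protected theorem add_mul (f g h : SpanAlg k H) : (f + g) * h = f * h + g * h := by
  simp only [mul_def, map_add, LinearMap.add_apply]

protected theorem mul_add (f g h : SpanAlg k H) : f * (g + h) = f * g + f * h := by
  simp only [mul_def, map_add]

protected theorem zero_mul (f : SpanAlg k H) : 0 * f = 0 := by
  simp only [mul_def, map_zero, LinearMap.zero_apply]

protected theorem mul_zero (f : SpanAlg k H) : f * 0 = 0 := by
  simp only [mul_def, map_zero]

protected theorem smul_mul (c : k) (f g : SpanAlg k H) : (c • f) * g = c • (f * g) := by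
  simp only [mul_def, map_smul, LinearMap.smul_apply]

protected theorem mul_smul (c : k) (f g : SpanAlg k H) : f * (c • g) = c • (f * g) := by
  simp only [mul_def, map_smul]

theorem of_assoc (p q r : Mor H) :
    (of p * of q * of r : SpanAlg k H) = of p * (of q * of r) := by
  obtain ⟨a, b, p⟩ := p
  obtain ⟨b', c, q⟩ := q
  obtain ⟨c', d, r⟩ := r
  by_cases h₁ : b = b'
  · subst h₁
    by_cases h₂ : c = c'
    · subst h₂
      simp only [of_mul_of_comp, PathSystem.assoc]
    · rw [of_mul_of_comp, of_mul_of_ne (p := ⟨a, c, _⟩) h₂,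
        of_mul_of_ne (p := ⟨b, c, q⟩) h₂, SpanAlg.mul_zero]
  · rw [of_mul_of_ne (p := ⟨a, b, p⟩) h₁, SpanAlg.zero_mul]
    by_cases h₂ : c = c'
    · subst h₂
      rw [of_mul_of_comp, of_mul_of_ne (p := ⟨a, b, p⟩) (q := ⟨b', d, _⟩) h₁]
    · rw [of_mul_of_ne (p := ⟨b', c, q⟩) h₂, SpanAlg.mul_zero]

protected theorem mul_assoc (f g h : SpanAlg k H) : f * g * h = f * (g * h) := by
  induction f using SpanAlg.induction with
  | zero => simp only [SpanAlg.zero_mul]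
  | add f₁ f₂ h₁ h₂ => simp only [SpanAlg.add_mul, h₁, h₂]
  | of x p =>
    induction g using SpanAlg.induction with
    | zero => simp only [SpanAlg.zero_mul, SpanAlg.mul_zero]
    | add g₁ g₂ h₁ h₂ => simp only [SpanAlg.add_mul, SpanAlg.mul_add, h₁, h₂]
    | of y q =>
      induction h using SpanAlg.induction with
      | zero => simp only [SpanAlg.mul_zero]
      | add g₁ g₂ h₁ h₂ => simp only [SpanAlg.mul_add, h₁, h₂]
      | of z r => simp only [SpanAlg.smul_mul, SpanAlg.mul_smul, of_assoc]

variable [Finite V]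

/-- The identity element is the sum of the identities at all vertices. -/
instance : One (SpanAlg k H) :=
  ⟨letI := Fintype.ofFinite V; ∑ a : V, of ⟨a, a, PathSystem.id a⟩⟩

theorem one_def : letI := Fintype.ofFinite V
    (1 : SpanAlg k H) = ∑ a : V, of ⟨a, a, PathSystem.id a⟩ := rfl

protected theorem one_mul (f : SpanAlg k H) : 1 * f = f := by
  let _ := Fintype.ofFinite V
  induction f using SpanAlg.induction with
  | zero => simp only [SpanAlg.mul_zero]
  | add f₁ f₂ h₁ h₂ => simp only [SpanAlg.mul_add, h₁, h₂]
  | of x p =>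
    rw [SpanAlg.mul_smul, one_def, mul_def, map_sum, LinearMap.sum_apply,
      Finset.sum_eq_single p.src]
    · rw [← mul_def]
      obtain ⟨a, b, p⟩ := p
      rw [of_mul_of_comp, PathSystem.id_comp]
    · intro b _ hb
      rw [← mul_def, of_mul_of_ne hb]
    · intro h
      exact absurd (Finset.mem_univ _) h

protected theorem mul_one (f : SpanAlg k H) : f * 1 = f := by
  let _ := Fintype.ofFinite V
  induction f using SpanAlg.induction with
  | zero => simp only [SpanAlg.zero_mul]
  | add f₁ f₂ h₁ h₂ => simp only [SpanAlg.add_mul, h₁, h₂]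
  | of x p =>
    rw [SpanAlg.smul_mul, one_def, mul_def, map_sum, Finset.sum_eq_single p.tgt]
    · rw [← mul_def]
      obtain ⟨a, b, p⟩ := p
      rw [of_mul_of_comp, PathSystem.comp_id]
    · intro b _ hb
      rw [← mul_def, of_mul_of_ne (Ne.symm hb)]
    · intro h
      exact absurd (Finset.mem_univ _) h

instance : Ring (SpanAlg k H) :=
  { (inferInstance : AddCommGroup (SpanAlg k H)) with
    mul := (· * ·)
    one := 1
    left_distrib := SpanAlg.mul_add
    right_distrib := SpanAlg.add_mul
    zero_mul := SpanAlg.zero_mul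
    mul_zero := SpanAlg.mul_zero
    mul_assoc := SpanAlg.mul_assoc
    one_mul := SpanAlg.one_mul
    mul_one := SpanAlg.mul_one }

instance : Algebra k (SpanAlg k H) := Algebra.ofModule SpanAlg.smul_mul SpanAlg.mul_smul

end SpanAlg

/-- The two-sided ideal generated by a set. -/
def idealSpan {A : Type*} [Ring A] (S : Set A) : Ideal A := (TwoSidedIdeal.span S).asIdeal

instance {A : Type*} [Ring A] (S : Set A) : (idealSpan S).IsTwoSided :=
  inferInstanceAs ((TwoSidedIdeal.span S).asIdeal.IsTwoSided)

/-! ## Path algebras, admissible ideals and relations -/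

section PathAlgebra

instance pathSystem (V : Type u) [Quiver.{v} V] : PathSystem (@Quiver.Path V _) where
  id _ := Quiver.Path.nil
  comp p q := p.comp q
  id_comp p := Quiver.Path.nil_comp p
  comp_id p := Quiver.Path.comp_nil p
  assoc p q r := Quiver.Path.comp_assoc p q r

/-- The paths of a quiver, each with its start and its end. -/
abbrev PathOf (V : Type u) [Quiver.{v} V] : Type (max u v) := Mor (@Quiver.Path V _)

/-- The path algebra of a quiver with vertex set `V`. -/
abbrev PathAlgebra (k : Type w) [Field k] (V : Type u) [Quiver.{v} V] : Type (max u v w) :=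
  SpanAlg k (@Quiver.Path V _)

variable (k : Type w) [Field k] (V : Type u) [Quiver.{v} V]

/-- The ideal `J` of the path algebra which is generated by the arrows. -/
def arrowIdeal [Finite V] : Ideal (PathAlgebra k V) :=
  idealSpan {x | ∃ (a b : V) (e : a ⟶ b), x = SpanAlg.of ⟨a, b, e.toPath⟩}

variable {k V}

/-- `J ^ n ⊆ I ⊆ J ^ 2` for some `n ≥ 2`. -/
def Admissible [Finite V] (I : Ideal (PathAlgebra k V)) : Prop :=
  ∃ n : ℕ, 2 ≤ n ∧ arrowIdeal k V ^ n ≤ I ∧ I ≤ arrowIdeal k V ^ 2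

/-- A linear combination of paths of length at least two, all with the same start and all with
the same end. -/
def IsRelation (ρ : PathAlgebra k V) : Prop :=
  ∃ a b : V, ∀ p ∈ ρ.supp, p.src = a ∧ p.tgt = b ∧ 2 ≤ p.hom.length

variable (V) in
/-- There is no oriented cycle (of positive length). -/
def Acyclic : Prop := ∀ (a : V) (p : Quiver.Path a a), p.length = 0

end PathAlgebra

/-! ## Generalized path algebras -/

/-- The `𝒜`-paths `a₁ β₁ a₂ ⋯ aₙ βₙ aₙ₊₁` from `i` to `j`: either an element of `A i`, or an
`𝒜`-path followed by an arrow and an element of the algebra at the end of this arrow. -/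
inductive APath {Γ : Type u} [Quiver.{v} Γ] (A : Γ → Type w) : Γ → Γ → Type (max u v w)
  | nil {i : Γ} (x : A i) : APath A i i
  | cons {i j l : Γ} (p : APath A i j) (β : j ⟶ l) (x : A l) : APath A i l

namespace APath

variable {Γ : Type u} [Quiver.{v} Γ] {A : Γ → Type w} [∀ i, Ring (A i)]

/-- Multiply the last entry of an `𝒜`-path by `y` on the right. -/
def mulLast : ∀ {i j : Γ}, APath A i j → A j → APath A i j
  | _, _, nil x, y => nil (x * y)
  | _, _, cons p β x, y => cons p β (x * y)

/-- `(a₁ β₁ ⋯ βₙ aₙ₊₁) (b₁ γ₁ ⋯ γₘ bₘ₊₁) = a₁ β₁ ⋯ βₙ (aₙ₊₁ b₁) γ₁ ⋯ γₘ bₘ₊₁`. -/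
def comp {i j : Γ} (p : APath A i j) : ∀ {l : Γ}, APath A j l → APath A i l
  | _, nil x => p.mulLast x
  | _, cons q β x => cons (p.comp q) β x

theorem mulLast_mulLast {i j : Γ} (p : APath A i j) (x y : A j) :
    (p.mulLast x).mulLast y = p.mulLast (x * y) := by
  cases p <;> simp only [mulLast, mul_assoc]

theorem mulLast_one {i j : Γ} (p : APath A i j) : p.mulLast 1 = p := by
  cases p <;> simp only [mulLast, mul_one]

theorem comp_mulLast {i j l : Γ} (p : APath A i j) (q : APath A j l) (x : A l) :
    p.comp (q.mulLast x) = (p.comp q).mulLast x := by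
  cases q with
  | nil y => exact (mulLast_mulLast p y x).symm
  | cons q β y => rfl

theorem one_comp {i j : Γ} (p : APath A i j) : (nil (1 : A i)).comp p = p := by
  induction p with
  | nil x => simp only [comp, mulLast, one_mul]
  | cons p β x ih => simp only [comp, ih]

theorem comp_assoc {i j l m : Γ} (p : APath A i j) (q : APath A j l) (r : APath A l m) :
    (p.comp q).comp r = p.comp (q.comp r) := by
  induction r with
  | nil x => simp only [comp, comp_mulLast]
  | cons r β x ih => simp only [comp, ih]

instance : PathSystem (APath A) where
  id _ := nil 1
  comp p q := p.comp q
  id_comp p := one_comp p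
  comp_id p := mulLast_one p
  assoc p q r := comp_assoc p q r

end APath

section GPA

variable (k : Type w) [Field k] {Γ : Type u} [Quiver.{v} Γ] [Finite Γ]
  (A : Γ → Type u') [∀ i, Ring (A i)] [∀ i, Algebra k (A i)]

/-- The multilinearity relations, as an ideal of the space `k[Γ, 𝒜]` spanned by the `𝒜`-paths.
By multiplying the generators, which live in length zero, by `𝒜`-paths on both sides one gets the
additivity and the homogeneity in each entry of each `𝒜`-path, and these span the ideal. -/
def multilinearIdeal : Ideal (SpanAlg k (APath A)) :=
  idealSpan
    ({f | ∃ (i : Γ) (x y : A i), f = SpanAlg.of ⟨i, i, APath.nil (x + y)⟩ -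
        (SpanAlg.of ⟨i, i, APath.nil x⟩ + SpanAlg.of ⟨i, i, APath.nil y⟩)} ∪
      {f | ∃ (i : Γ) (c : k) (x : A i), f = SpanAlg.of ⟨i, i, APath.nil (c • x)⟩ -
        c • SpanAlg.of ⟨i, i, APath.nil x⟩})

instance : (multilinearIdeal k A).IsTwoSided := inferInstanceAs ((idealSpan _).IsTwoSided)

/-- The generalized path algebra `k(Γ, 𝒜)`. -/
abbrev GPA := SpanAlg k (APath A) ⧸ multilinearIdeal k A

variable {A}

/-- The class of an `𝒜`-path in `k(Γ, 𝒜)`. -/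
def GPA.of {i j : Γ} (p : APath A i j) : GPA k A :=
  Ideal.Quotient.mk (multilinearIdeal k A) (SpanAlg.of ⟨i, j, p⟩)

end GPA

/-! ## Generalized bound path algebras -/

/-- The data which enter a gbp-algebra over the quiver `Γ`: for each vertex `i` a quiver `Σ i`
and a set `Ω i` in its path algebra, and a set `I` in the path algebra of `Γ`. The conditions on
these data are in `GbpData.IsGbp`. -/
structure GbpData (k : Type w) [Field k] (Γ : Type u) [Quiver.{v} Γ] where
  fiber : Γ → Type u'
  [quiver : ∀ i, Quiver.{v'} (fiber i)]
  [finite : ∀ i, Finite (fiber i)]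
  Ω : ∀ i, Set (PathAlgebra k (fiber i))
  I : Set (PathAlgebra k Γ)

attribute [instance] GbpData.quiver GbpData.finite

namespace GbpData

variable {k : Type w} [Field k] {Γ : Type u} [Quiver.{v} Γ] (D : GbpData.{u, v, w, u', v'} k Γ)

/-- The algebra `A i = kΣ i / (Ω i)` at the vertex `i`. -/
abbrev vertexAlg (i : Γ) : Type (max u' v' w) := PathAlgebra k (D.fiber i) ⧸ idealSpan (D.Ω i)

/-- The class in `A i` of a path of `Σ i`. -/
def pathClass {i : Γ} (γ : PathOf (D.fiber i)) : D.vertexAlg i :=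
  Ideal.Quotient.mk (idealSpan (D.Ω i)) (SpanAlg.of γ)

/-- `D.Insertion β p` says that `p` arises from the path `β = β₁ ⋯ βₘ` of `Γ`, where `m ≥ 1`, by
inserting classes of paths between consecutive arrows: `p = 1 β₁ γ₁ β₂ γ₂ ⋯ γₘ₋₁ βₘ 1`, with `γⱼ`
the class of a path in the quiver at the end of `βⱼ`. -/
inductive Insertion : ∀ {i j : Γ}, Quiver.Path i j → APath D.vertexAlg i j → Prop
  | single {i j : Γ} (β : i ⟶ j) :
      Insertion β.toPath (APath.cons (APath.nil 1) β 1)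
  | cons {i j l : Γ} {q : Quiver.Path i j} {p : APath D.vertexAlg i j} (h : Insertion q p)
      (γ : PathOf (D.fiber j)) (β : j ⟶ l) :
      Insertion (q.cons β) (APath.cons (p.mulLast (D.pathClass γ)) β 1)

variable [Finite Γ]

/-- The set `𝒜(I)` in `k(Γ, 𝒜)`: in each path that occurs in a relation of `I`, classes of paths
are inserted between consecutive arrows, independently for the different paths. -/
def insertedRelations : Set (GPA k D.vertexAlg) :=
  {x | ∃ ρ ∈ D.I, ∃ f : ∀ β : PathOf Γ, APath D.vertexAlg β.src β.tgt,
    (∀ β ∈ ρ.supp, D.Insertion β.hom (f β)) ∧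
    x = ∑ β ∈ ρ.supp, ρ.coeff β • GPA.of k (f β)}

/-- The algebra `k(Γ, 𝒜, I) = k(Γ, 𝒜) / (𝒜(I))`. -/
abbrev Alg := GPA k D.vertexAlg ⧸ idealSpan D.insertedRelations

/-- The conditions under which `k(Γ, 𝒜, I)` is a gbp-algebra: all quivers are finite, each `A i`
is the quotient of a path algebra by an admissible ideal generated by a finite set of relations,
and `I` is a finite set of relations generating an admissible ideal. -/
structure IsGbp : Prop where
  finite_arrows : ∀ i j : Γ, Finite (i ⟶ j)
  finite_fiber_arrows : ∀ (i : Γ) (x y : D.fiber i), Finite (x ⟶ y)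
  finite_Ω : ∀ i, (D.Ω i).Finite
  relation_Ω : ∀ i, ∀ ω ∈ D.Ω i, IsRelation ω
  admissible_Ω : ∀ i, Admissible (idealSpan (D.Ω i))
  finite_I : D.I.Finite
  relation_I : ∀ ρ ∈ D.I, IsRelation ρ
  admissible_I : Admissible (idealSpan D.I)

/-- `k(Γ, 𝒜, I)` is a gbp-algebra which is isomorphic to `A` as a `k`-algebra. -/
def IsSimplification (A : Type*) [Ring A] [Algebra k A] : Prop :=
  D.IsGbp ∧ Nonempty (A ≃ₐ[k] D.Alg)

/-- A simplification whose quiver is acyclic. -/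
def IsSimplificationWithoutCycles (A : Type*) [Ring A] [Algebra k A] : Prop :=
  D.IsSimplification A ∧ Acyclic Γ

end GbpData

/-! ## Equivalence relations on the vertices of a quiver -/

/-- The vertices of the quotient of a quiver by an equivalence relation on its vertices. -/
def QuotientQuiver (W : Type u) [Quiver.{v} W] (r : Setoid W) : Type u := Quotient r

namespace QuotientQuiver

variable {W : Type u} [Quiver.{v} W] {r : Setoid W}

/-- The class of a vertex. -/
def mk (r : Setoid W) (x : W) : QuotientQuiver W r := Quotient.mk r x

theorem sound {x y : W} (h : r x y) : mk r x = mk r y := Quotient.sound h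

instance [Finite W] : Finite (QuotientQuiver W r) := inferInstanceAs (Finite (Quotient r))

/-- The number of arrows from `a` to `b` is the maximum of the numbers of arrows from `x` to `y`,
for `x` in `a` and `y` in `b`. -/
instance : Quiver.{0} (QuotientQuiver W r) :=
  ⟨fun a b => Fin (sSup {n : ℕ | ∃ x y : W, mk r x = a ∧ mk r y = b ∧ n = Nat.card (x ⟶ y)})⟩

end QuotientQuiver

section EquivRel

variable {V : Type u} [Quiver.{v} V]

/-- The vertices of the reduced quiver. -/
def Reduced (_ : Setoid V) : Type u := V

instance (r : Setoid V) [Finite V] : Finite (Reduced r) := inferInstanceAs (Finite V)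

/-- The arrows of the reduced quiver are the arrows whose start and end are not equivalent. -/
instance (r : Setoid V) : Quiver.{v} (Reduced r) :=
  ⟨fun x y => {_e : @Quiver.Hom V _ x y // ¬ r x y}⟩

/-- The equivalence relation, on the vertices of the reduced quiver. -/
def redSetoid (r : Setoid V) : Setoid (Reduced r) := r

/-- The quotient of the reduced quiver. -/
abbrev RedQuot (r : Setoid V) : Type u := QuotientQuiver (Reduced r) (redSetoid r)

/-- The class of a vertex, as a vertex of the quotient of the reduced quiver. -/
def cls (r : Setoid V) (x : V) : RedQuot r := QuotientQuiver.mk (redSetoid r) x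

theorem cls_sound {r : Setoid V} {x y : V} (h : r x y) : cls r x = cls r y :=
  QuotientQuiver.sound (r := redSetoid r) h

/-- The full subquiver whose vertices are those in the class `c`. -/
def FullSub (r : Setoid V) (c : RedQuot r) : Type u := {x : V // cls r x = c}

instance (r : Setoid V) (c : RedQuot r) [Finite V] : Finite (FullSub r c) :=
  inferInstanceAs (Finite {x : V // cls r x = c})

instance (r : Setoid V) (c : RedQuot r) : Quiver.{v} (FullSub r c) :=
  ⟨fun x y => @Quiver.Hom V _ x.1 y.1⟩

/-- The inclusion of the full subquiver of a class. -/
def FullSub.incl (r : Setoid V) (c : RedQuot r) : FullSub r c ⥤q V where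
  obj x := x.1
  map e := e

/-- The inclusion of the path algebra of the full subquiver of a class. -/
def FullSub.inclLin (k : Type w) [Field k] (r : Setoid V) (c : RedQuot r) :
    PathAlgebra k (FullSub r c) →ₗ[k] PathAlgebra k V :=
  SpanAlg.map fun p => ⟨p.src.1, p.tgt.1, (FullSub.incl r c).mapPath p.hom⟩

/-- The equivalence relation is coherent with the arrows: (1) the ends of each arrow in an oriented
cycle are equivalent; (2) equivalent vertices have the same numbers of arrows to, and from, each
vertex outside of their class. -/
structure Coherent (r : Setoid V) : Prop where
  cycle : ∀ {a i j : V}, Quiver.Path a i → (i ⟶ j) → Quiver.Path j a → r i j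
  card_out : ∀ i j l : V, r i j → ¬ r j l → Nat.card (i ⟶ l) = Nat.card (j ⟶ l)
  card_in : ∀ i j l : V, r i j → ¬ r j l → Nat.card (l ⟶ i) = Nat.card (l ⟶ j)

/-- A labelling: a quiver morphism from the reduced quiver to its quotient, which is the canonical
projection on the vertices and is bijective on the arrows between any two given vertices. -/
structure Labelling (r : Setoid V) where
  map : ∀ {x y : Reduced r}, (x ⟶ y) → (cls r x ⟶ cls r y)
  bijective : ∀ x y : Reduced r, Function.Bijective (map (x := x) (y := y))

open Classical in
/-- The path over the quotient quiver which is induced by a path: arrows inside of a class are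
dropped, and the labelling is applied to the other arrows. -/
def Labelling.path {r : Setoid V} (z : Labelling r) :
    ∀ {a b : V}, Quiver.Path a b → Quiver.Path (cls r a) (cls r b)
  | _, _, .nil => .nil
  | _, _, .cons (b := b) (c := c) p e =>
    if h : r b c then (z.path p).cast rfl (cls_sound h)
    else (z.path p).cons (z.map (x := b) (y := c) ⟨e, h⟩)

/-- `Labelling.path` on paths with unspecified ends. -/
def Labelling.mor {r : Setoid V} (z : Labelling r) (p : PathOf V) : PathOf (RedQuot r) :=
  ⟨cls r p.src, cls r p.tgt, z.path p.hom⟩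

/-- A path is straightforward if the part before the first arrow between different classes and the
part after the last such arrow have length zero. That is: if the path has positive length, then
its first arrow and its last arrow are between different classes. -/
def Straightforward (r : Setoid V) {a b : V} (p : Quiver.Path a b) : Prop :=
  (∀ (c : V) (e : a ⟶ c) (q : Quiver.Path c b), p = e.toPath.comp q → ¬ r a c) ∧
  (∀ (c : V) (q : Quiver.Path a c) (e : c ⟶ b), p = q.cons e → ¬ r c b)

variable {k : Type w} [Field k] {r : Setoid V}

/-- All paths in the relation induce paths of length zero. -/
def Internal (z : Labelling r) (ρ : PathAlgebra k V) : Prop :=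
  ∀ p ∈ ρ.supp, (z.mor p).hom.length = 0

/-- All paths in the relation are straightforward, and distinct ones induce distinct paths. -/
def External (z : Labelling r) (ρ : PathAlgebra k V) : Prop :=
  (∀ p ∈ ρ.supp, Straightforward r p.hom) ∧
  (∀ p ∈ ρ.supp, ∀ q ∈ ρ.supp, p ≠ q → z.mor p ≠ z.mor q)

/-- The relations in `R` which involve only vertices of the class `c`, as elements of the path
algebra of the full subquiver of `c`. -/
def internalRelations (r : Setoid V) (R : Set (PathAlgebra k V)) (c : RedQuot r) :
    Set (PathAlgebra k (FullSub r c)) :=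
  {ω | FullSub.inclLin k r c ω ∈ R}

/-- The relations `z(ρ)` on the quotient quiver, for the external relations `ρ` in `R`. -/
def externalRelations (z : Labelling r) (R : Set (PathAlgebra k V)) :
    Set (PathAlgebra k (RedQuot r)) :=
  SpanAlg.map z.mor '' {ρ | ρ ∈ R ∧ External z ρ}

/-- The set `R` of relations is compatible with the equivalence relation, relative to `z`. In
`exchange`, the paths `η p` have a common start and a common end, as is necessary for their linear
combination to be a relation. -/
structure Compatible [Finite V] (z : Labelling r) (R : Set (PathAlgebra k V)) : Prop where
  internal_or_external : ∀ ρ ∈ R, Internal z ρ ∨ External z ρ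
  admissible : ∀ c : RedQuot r, Admissible (idealSpan (internalRelations r R c))
  exchange : ∀ ρ ∈ R, External z ρ → ∀ (a b : V) (η : PathOf V → Quiver.Path a b),
    (∀ p ∈ ρ.supp, Straightforward r (η p) ∧ z.mor ⟨a, b, η p⟩ = z.mor p) →
    ∑ p ∈ ρ.supp, ρ.coeff p • SpanAlg.of ⟨a, b, η p⟩ ∈ R

/-- The gbp-algebra `A(∼)` associated with the equivalence relation: the quiver is the quotient of
the reduced quiver, the algebra at a class is that of its full subquiver bound by the internal
relations, and the relations on the quotient are the images of the external relations. -/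
def assocGbp [Finite V] (z : Labelling r) (R : Set (PathAlgebra k V)) :
    GbpData.{u, 0, w, u, v} k (RedQuot r) where
  fiber c := FullSub r c
  Ω c := internalRelations r R c
  I := externalRelations z R

end EquivRel

end

end GenPathAlg

open GenPathAlg

namespace GenPathAlg

universe u v w u' v' w'

noncomputable section

/-! ## Two-sided ideals generated by a set -/

/-! Write `e_x` for the trivial path at `x`. A labelling is bijective on the arrows between any two
given vertices, so an arrow `β : i ⟶ j` of the quotient quiver `Γ` has exactly one lift `x ⟶ y` for
each `x` in `i` and each `y` in `j` (`Labelling.lift`). Hence `β` stands for the sum of all its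
lifts, and a single lift is recovered from `β` as `e_x β e_y`. This dictionary gives a homomorphism
in each direction. From `kQ/(R)` to `A(∼)` (`toAssoc`), a path inside a class goes to its class in
the vertex algebra, and an arrow `e : x ⟶ y` between classes goes to `e_x z(e) e_y`. From `A(∼)` to
`kQ/(R)` (`boundRep`), the vertex algebras are included and `β` goes to the sum of its lifts. They
are mutually inverse on generators, because the `e_x` with `x` in `c` sum to the identity of `A_c`.

The work lies in the relations. An internal relation lives in a single `kΣ_c` and vanishes in `A_c`.
A straightforward path `p` of positive length from `a` to `b` has value `e_a f e_b`, where `f` is an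
insertion into `z(p)` (`Straightforward.exists_insertion`); so an external relation goes to `e_a s
e_b` with `s` in `𝒜(I)`, which is zero (`toAssoc_external`). Conversely, if `f` is an insertion into
a path of `Γ` and `a`, `b` lie in the end classes, then `e_a f e_b` is a straightforward path over
the same path of `Γ` (`exists_straightforward`). Thus the component at `a`, `b` of an element of
`𝒜(I)` is a combination which the exchange condition puts into `R` (`annihilates_boundRep`).

An oriented cycle of `Γ` would lift to one of `Q` containing an arrow between inequivalent vertices,
against coherence. Since `Γ` is finite and acyclic, a power of its arrow ideal is zero, so `I`
generates an admissible ideal as soon as it consists of relations. It does, because the first and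
the last arrow of a straightforward path survive under `z`. -/

theorem subset_idealSpan {A : Type*} [Ring A] (S : Set A) : S ⊆ idealSpan S :=
  TwoSidedIdeal.subset_span

theorem idealSpan_le {A : Type*} [Ring A] {S : Set A} {I : Ideal A} [I.IsTwoSided]
    (h : S ⊆ I) : idealSpan S ≤ I := by
  have h' : TwoSidedIdeal.span S ≤ I.toTwoSided :=
    TwoSidedIdeal.span_le.2 fun x hx => Ideal.mem_toTwoSided.2 (h hx)
  intro x hx
  exact Ideal.mem_toTwoSided.1 (h' hx)

theorem eq_zero_of_mem_idealSpan {A B F : Type*} [Ring A] [Ring B] [FunLike F A B]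
    [RingHomClass F A B] {S : Set A} (f : F)
    (h : ∀ x ∈ S, f x = 0) {x : A} (hx : x ∈ idealSpan S) : f x = 0 := by
  have : idealSpan S ≤ RingHom.ker f := idealSpan_le fun y hy => h y hy
  exact this hx

/-- A map which is additive and multiplicative, but does not need to preserve the identity,
sends the two-sided ideal generated by `S` into each two-sided ideal containing the image of `S`. -/
theorem map_mem_of_mem_idealSpan {A B F : Type*} [Ring A] [Ring B] [FunLike F A B]
    [NonUnitalRingHomClass F A B] {S : Set A} (f : F) {I : Ideal B} [I.IsTwoSided]
    (h : ∀ x ∈ S, f x ∈ I) {x : A} (hx : x ∈ idealSpan S) : f x ∈ I := by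
  let K : TwoSidedIdeal A := .mk' {x | f x ∈ I} (by simp) (by
    intro x y hx hy; simpa using I.add_mem hx hy) (by intro x hx; simpa using hx)
    (by intro x y hy; simpa using I.mul_mem_left _ hy)
    (by intro x y hx; simpa using I.mul_mem_right _ hx)
  have h' : TwoSidedIdeal.span S ≤ K :=
    TwoSidedIdeal.span_le.2 fun x hx => (TwoSidedIdeal.mem_mk' _ _ _ _ _ _ _).2 (h x hx)
  exact (TwoSidedIdeal.mem_mk' {x | f x ∈ I} _ _ _ _ _ x).1 (h' hx)

namespace SpanAlg

variable {k : Type w} [Field k] {V : Type u} {H : V → V → Type v}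

theorem eq_sum (f : SpanAlg k H) : f = ∑ p ∈ f.supp, f.coeff p • of p := by
  refine (Finsupp.sum_single (show Mor H →₀ k from f)).symm.trans ?_
  refine Finset.sum_congr rfl fun p _ => ?_
  refine Eq.symm ((Finsupp.smul_single _ p (1 : k)).trans ?_)
  rw [smul_eq_mul, mul_one]; rfl

theorem linearMap_ext {N : Type*} [AddCommGroup N] [Module k N] {φ ψ : SpanAlg k H →ₗ[k] N}
    (h : ∀ p, φ (of p) = ψ (of p)) : φ = ψ := by
  ext f
  induction f using SpanAlg.induction with
  | zero => simp
  | add f g hf hg => simp [hf, hg]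
  | of c p => simp [h]

theorem map_of {V' : Type u'} {H' : V' → V' → Type v'} (φ : Mor H → Mor H') (p : Mor H) :
    map (k := k) φ (of p) = of (φ p) := linExt_of _ _

theorem map_eq_mapDomain {V' : Type u'} {H' : V' → V' → Type v'} (φ : Mor H → Mor H')
    (f : SpanAlg k H) : map φ f = Finsupp.mapDomain φ (show Mor H →₀ k from f) := by
  have h : map φ = (Finsupp.lmapDomain k k φ : SpanAlg k H →ₗ[k] SpanAlg k H') :=
    linearMap_ext fun p =>
      (map_of φ p).trans (Finsupp.mapDomain_single (f := φ) (a := p) (b := (1 : k))).symm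
  exact LinearMap.congr_fun h f

/-- Injectivity on the support rules out cancellation. The intended `φ` is the map induced by a
labelling, which is injective on the support of an external relation only. -/
theorem supp_map {V' : Type u'} {H' : V' → V' → Type v'} [DecidableEq (Mor H')]
    (φ : Mor H → Mor H') (f : SpanAlg k H)
    (hφ : Set.InjOn φ f.supp) : (map φ f).supp = f.supp.image φ := by
  rw [map_eq_mapDomain]
  exact Finsupp.mapDomain_support_of_injOn _ hφ

theorem coeff_map {V' : Type u'} {H' : V' → V' → Type v'} (φ : Mor H → Mor H')
    (f : SpanAlg k H) (hφ : Set.InjOn φ f.supp) {p : Mor H} (hp : p ∈ f.supp) :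
    (map φ f).coeff (φ p) = f.coeff p := by
  rw [map_eq_mapDomain]
  exact Finsupp.mapDomain_apply' (f.supp : Set (Mor H)) _ (fun _ h => h) hφ hp

theorem map_injective {V' : Type u'} {H' : V' → V' → Type v'} {φ : Mor H → Mor H'}
    (hφ : Function.Injective φ) : Function.Injective (map (k := k) φ) := by
  intro f g h
  rw [map_eq_mapDomain, map_eq_mapDomain] at h
  exact Finsupp.mapDomain_injective hφ h

variable [PathSystem H]

theorem one_eq_sum [Fintype V] :
    (1 : SpanAlg k H) = ∑ a : V, of ⟨a, a, PathSystem.id a⟩ := by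
  rw [one_def]
  congr!

/-- The algebra homomorphism which is given on the basis by a multiplicative function. -/
def lift [Fintype V] {C : Type*} [Ring C] [Algebra k C] (φ : Mor H → C)
    (comp : ∀ {a b c} (p : H a b) (q : H b c),
      φ ⟨a, c, PathSystem.comp p q⟩ = φ ⟨a, b, p⟩ * φ ⟨b, c, q⟩)
    (ne : ∀ p q : Mor H, p.tgt ≠ q.src → φ p * φ q = 0)
    (one : ∑ a : V, φ ⟨a, a, PathSystem.id a⟩ = 1) : SpanAlg k H →ₐ[k] C :=
  AlgHom.ofLinearMap (linExt φ) (by simp only [one_eq_sum, map_sum, linExt_of, one]) (by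
    intro f g
    induction f using SpanAlg.induction with
    | zero => simp
    | add f₁ f₂ h₁ h₂ => simp only [_root_.add_mul, map_add, h₁, h₂]
    | of x p =>
      induction g using SpanAlg.induction with
      | zero => simp
      | add g₁ g₂ h₁ h₂ => simp only [_root_.mul_add, map_add, h₁, h₂]
      | of y q =>
        rw [smul_mul_smul_comm, map_smul, map_smul, map_smul, smul_mul_smul_comm]
        congr 1
        simp only [linExt_of]
        by_cases h : p.tgt = q.src
        · obtain ⟨a, b, p⟩ := p
          obtain ⟨b', c, q⟩ := q
          obtain rfl : b = b' := h
          rw [of_mul_of_comp, linExt_of, comp]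
        · rw [of_mul_of_ne h, ne p q h, map_zero])

theorem lift_of [Fintype V] {C : Type*} [Ring C] [Algebra k C] (φ : Mor H → C)
    (comp ne one) (p : Mor H) : lift (k := k) φ comp ne one (of p) = φ p := linExt_of _ _

theorem algHom_ext [Finite V] {C : Type*} [Ring C] [Algebra k C] {φ ψ : SpanAlg k H →ₐ[k] C}
    (h : ∀ p, φ (of p) = ψ (of p)) : φ = ψ :=
  AlgHom.toLinearMap_injective (linearMap_ext h)

end SpanAlg

/-! ## Representations of quivers in algebras -/

/-- A representation of a quiver in an algebra `C`, which defines a homomorphism from the path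
algebra to `C`. -/
structure PathRep (V : Type u) [Quiver.{v} V] [Fintype V] (C : Type*) [Ring C] where
  idem : V → C
  arrow : ∀ {a b : V}, (a ⟶ b) → C
  idem_mul_self : ∀ a, idem a * idem a = idem a
  idem_mul_ne : ∀ a b, a ≠ b → idem a * idem b = 0
  sum_idem : ∑ a, idem a = 1
  idem_mul_arrow : ∀ {a b : V} (e : a ⟶ b), idem a * arrow e = arrow e
  arrow_mul_idem : ∀ {a b : V} (e : a ⟶ b), arrow e * idem b = arrow e

namespace PathRep

variable {k : Type w} [Field k] {V : Type u} [Quiver.{v} V] [Fintype V] {C : Type w'} [Ring C]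
  (P : PathRep V C)

/-- The value of a representation at a path. -/
def val {a : V} : ∀ {b : V}, Quiver.Path a b → C
  | _, .nil => P.idem a
  | _, .cons p e => val p * P.arrow e

theorem idem_mul_val {a b : V} (p : Quiver.Path a b) : P.idem a * P.val p = P.val p := by
  induction p with
  | nil => exact P.idem_mul_self a
  | cons p e ih => rw [val, ← mul_assoc, ih]

theorem val_mul_idem {a b : V} (p : Quiver.Path a b) : P.val p * P.idem b = P.val p := by
  cases p with
  | nil => exact P.idem_mul_self a
  | cons p e => rw [val, mul_assoc, P.arrow_mul_idem]

theorem val_comp {a b c : V} (p : Quiver.Path a b) (q : Quiver.Path b c) :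
    P.val (p.comp q) = P.val p * P.val q := by
  induction q with
  | nil => exact (P.val_mul_idem p).symm
  | cons q e ih => rw [Quiver.Path.comp_cons, val, val, ih, mul_assoc]

/-- The algebra homomorphism defined by a representation of a quiver. -/
def algHom [Algebra k C] : PathAlgebra k V →ₐ[k] C :=
  SpanAlg.lift (fun p => P.val p.hom) (fun p q => P.val_comp p q)
    (fun p q h => by
      rw [← P.val_mul_idem p.hom, ← P.idem_mul_val q.hom, mul_assoc,
        ← mul_assoc (P.idem _) (P.idem _), P.idem_mul_ne _ _ h, zero_mul, mul_zero])
    P.sum_idem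

theorem algHom_of [Algebra k C] (p : PathOf V) :
    P.algHom (SpanAlg.of p : PathAlgebra k V) = P.val p.hom := SpanAlg.lift_of _ _ _ _ _

end PathRep

theorem PathAlgebra.of_cons {k : Type w} [Field k] {V : Type u} [Quiver.{v} V]
    {a b c : V} (p : Quiver.Path a b) (e : b ⟶ c) :
    (SpanAlg.of ⟨a, c, p.cons e⟩ : PathAlgebra k V) =
      SpanAlg.of ⟨a, b, p⟩ * SpanAlg.of ⟨b, c, e.toPath⟩ :=
  (SpanAlg.of_mul_of_comp p e.toPath).symm

/-! ## Representations of generalized path algebras -/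

/-- The data and conditions which define a homomorphism from a generalized path algebra to `C`. -/
structure APathRep (k : Type w) [Field k] {Γ : Type u} [Quiver.{v} Γ] [Fintype Γ]
    (A : Γ → Type u') [∀ i, Ring (A i)] [∀ i, Algebra k (A i)] (C : Type*) [Ring C]
    [Algebra k C] where
  entry : ∀ i, A i →ₗ[k] C
  arrow : ∀ {i j : Γ}, (i ⟶ j) → C
  entry_mul : ∀ (i) (x y : A i), entry i (x * y) = entry i x * entry i y
  entry_mul_ne : ∀ (i j) (x : A i) (y : A j), i ≠ j → entry i x * entry j y = 0
  sum_entry_one : ∑ i, entry i 1 = 1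
  one_mul_arrow : ∀ {i j : Γ} (β : i ⟶ j), entry i 1 * arrow β = arrow β
  arrow_mul_one : ∀ {i j : Γ} (β : i ⟶ j), arrow β * entry j 1 = arrow β

namespace APathRep

variable {k : Type w} [Field k] {Γ : Type u} [Quiver.{v} Γ] [Fintype Γ]
  {A : Γ → Type u'} [∀ i, Ring (A i)] [∀ i, Algebra k (A i)] {C : Type w'} [Ring C]
  [Algebra k C] (P : APathRep k A C)

/-- The value of a representation at an `𝒜`-path. -/
def val {i : Γ} : ∀ {j : Γ}, APath A i j → C
  | _, .nil x => P.entry i x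
  | _, .cons (l := l) p β x => val p * P.arrow β * P.entry l x

theorem val_mulLast {i j : Γ} (p : APath A i j) (x : A j) :
    P.val (p.mulLast x) = P.val p * P.entry j x := by
  cases p with
  | nil y => exact P.entry_mul i y x
  | cons p β y => simp only [APath.mulLast, val, P.entry_mul, mul_assoc]

theorem val_mul_one {i j : Γ} (p : APath A i j) : P.val p * P.entry j 1 = P.val p := by
  rw [← val_mulLast, APath.mulLast_one]

theorem one_mul_val {i j : Γ} (p : APath A i j) : P.entry i 1 * P.val p = P.val p := by
  induction p with
  | nil x => rw [val, ← P.entry_mul, one_mul]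
  | cons p β x ih => rw [val, ← mul_assoc, ← mul_assoc, ih]

theorem val_comp {i j l : Γ} (p : APath A i j) (q : APath A j l) :
    P.val (p.comp q) = P.val p * P.val q := by
  induction q with
  | nil x => exact P.val_mulLast p x
  | cons q β x ih => simp only [APath.comp, val, ih, mul_assoc]

/-- The algebra homomorphism on the space spanned by the `𝒜`-paths. -/
def spanHom : SpanAlg k (APath A) →ₐ[k] C :=
  SpanAlg.lift (fun p => P.val p.hom) (fun p q => P.val_comp p q)
    (fun p q h => by
      rw [← P.val_mul_one p.hom, ← P.one_mul_val q.hom, mul_assoc,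
        ← mul_assoc (P.entry _ _) (P.entry _ _), P.entry_mul_ne _ _ _ _ h, zero_mul, mul_zero])
    P.sum_entry_one

theorem spanHom_of (p : Mor (APath A)) : P.spanHom (SpanAlg.of p) = P.val p.hom :=
  SpanAlg.lift_of _ _ _ _ _

/-- The algebra homomorphism on the generalized path algebra. -/
def gpaHom : GPA k A →ₐ[k] C :=
  Ideal.Quotient.liftₐ (multilinearIdeal k A) P.spanHom fun x hx =>
    eq_zero_of_mem_idealSpan P.spanHom (by
      rintro _ (⟨i, x, y, rfl⟩ | ⟨i, c, x, rfl⟩)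
      · simp only [map_sub, map_add, spanHom_of, val, sub_self]
      · simp only [map_sub, map_smul, spanHom_of, val, sub_self]) hx

theorem gpaHom_of {i j : Γ} (p : APath A i j) : P.gpaHom (GPA.of k p) = P.val p :=
  P.spanHom_of ⟨i, j, p⟩

end APathRep

namespace GPA

variable {k : Type w} [Field k] {Γ : Type u} [Quiver.{v} Γ] [Finite Γ]
  {A : Γ → Type u'} [∀ i, Ring (A i)] [∀ i, Algebra k (A i)]

theorem of_mul_of {i j l : Γ} (p : APath A i j) (q : APath A j l) :
    GPA.of k p * GPA.of k q = GPA.of k (p.comp q) := by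
  rw [of, of, ← map_mul, SpanAlg.of_mul_of_comp]; rfl

theorem of_mul_of_ne {i j j' l : Γ} (p : APath A i j) (q : APath A j' l) (h : j ≠ j') :
    GPA.of k p * GPA.of k q = 0 := by
  rw [of, of, ← map_mul, SpanAlg.of_mul_of_ne (by exact h), map_zero]

theorem one_eq_sum {k : Type w} [Field k] {Γ : Type u} [Quiver.{v} Γ] [Fintype Γ]
    {A : Γ → Type u'} [∀ i, Ring (A i)] [∀ i, Algebra k (A i)] :
    (1 : GPA k A) = ∑ i, GPA.of k (APath.nil (1 : A i)) := by
  rw [← map_one (Ideal.Quotient.mk (multilinearIdeal k A)), SpanAlg.one_eq_sum, map_sum]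
  rfl

/-- The inclusion of the algebra at a vertex. -/
def entry (k : Type w) [Field k] {Γ : Type u} [Quiver.{v} Γ] [Finite Γ]
    (A : Γ → Type u') [∀ i, Ring (A i)] [∀ i, Algebra k (A i)] (i : Γ) : A i →ₗ[k] GPA k A where
  toFun x := GPA.of k (APath.nil x)
  map_add' x y := by
    rw [of, of, of, ← map_add]
    exact (Ideal.Quotient.mk_eq_mk_iff_sub_mem _ _).2
      (subset_idealSpan _ (Or.inl ⟨i, x, y, rfl⟩))
  map_smul' c x := by
    change _ = c • Ideal.Quotient.mkₐ k (multilinearIdeal k A) _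
    rw [of, ← map_smul]
    exact (Ideal.Quotient.mk_eq_mk_iff_sub_mem _ _).2
      (subset_idealSpan _ (Or.inr ⟨i, c, x, rfl⟩))

/-- Each `𝒜`-path is a product of entries and of elements `1 β 1`, by splitting off its last arrow
and its last entry. -/
theorem algHom_ext {C : Type*} [Ring C] [Algebra k C] {φ ψ : GPA k A →ₐ[k] C}
    (nil : ∀ (i) (x : A i), φ (GPA.of k (.nil x)) = ψ (GPA.of k (.nil x)))
    (arrow : ∀ {i j : Γ} (β : i ⟶ j), φ (GPA.of k (.cons (.nil 1) β 1)) =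
      ψ (GPA.of k (.cons (.nil 1) β 1))) : φ = ψ := by
  apply Ideal.Quotient.algHom_ext
  apply SpanAlg.algHom_ext
  rintro ⟨i, j, p⟩
  change φ (GPA.of k p) = ψ (GPA.of k p)
  induction p with
  | nil x => exact nil _ x
  | @cons j l p β x ih =>
    have h : GPA.of k (p.cons β x) =
        GPA.of k p * GPA.of k (.cons (.nil 1) β 1) * GPA.of k (.nil x) := by
      rw [of_mul_of, of_mul_of]
      simp only [APath.comp, APath.mulLast_one]
      simp only [APath.mulLast, one_mul]
    rw [h, map_mul, map_mul, map_mul, map_mul, ih, nil, arrow]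

end GPA

/-! ## Powers of the arrow ideal -/

section Length

variable {k : Type w} [Field k] {V : Type u} [Quiver.{v} V]

variable (k V) in
/-- The span of the paths of length at least `n`. -/
def lengthSpan (n : ℕ) : Submodule k (PathAlgebra k V) :=
  Submodule.span k (SpanAlg.of '' {p | n ≤ p.hom.length})

theorem of_mem_lengthSpan {n : ℕ} {p : PathOf V} (h : n ≤ p.hom.length) :
    (SpanAlg.of p : PathAlgebra k V) ∈ lengthSpan k V n :=
  Submodule.subset_span ⟨p, h, rfl⟩

theorem mem_lengthSpan_zero (f : PathAlgebra k V) : f ∈ lengthSpan k V 0 := by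
  rw [SpanAlg.eq_sum f]
  exact Submodule.sum_mem _ fun p _ => Submodule.smul_mem _ _ (of_mem_lengthSpan (Nat.zero_le _))

/-- `S` is the set of vertices visited by `p`. That each of them leads to the end of `p` is the
invariant of the induction: if the next vertex were already in `S`, the new arrow would close an
oriented cycle. -/
theorem Acyclic.exists_finset (h : Acyclic V) {a b : V} (p : Quiver.Path a b) :
    ∃ S : Finset V, S.card = p.length + 1 ∧ ∀ x ∈ S, Nonempty (Quiver.Path x b) := by
  classical
  induction p with
  | nil => exact ⟨{a}, rfl, fun x hx => by
      rw [Finset.mem_singleton] at hx; subst hx; exact ⟨.nil⟩⟩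
  | @cons b c p e ih =>
    obtain ⟨S, hS, hp⟩ := ih
    have hc : c ∉ S := fun hc => by
      obtain ⟨q⟩ := hp c hc
      exact absurd (h c (q.cons e)) (Nat.succ_ne_zero _)
    refine ⟨insert c S, by rw [Finset.card_insert_of_notMem hc, hS]; rfl, fun x hx => ?_⟩
    rcases Finset.mem_insert.1 hx with rfl | hx
    · exact ⟨.nil⟩
    · obtain ⟨q⟩ := hp x hx
      exact ⟨q.cons e⟩

variable [Finite V]

theorem mul_mem_lengthSpan {m n : ℕ} {f g : PathAlgebra k V} (hf : f ∈ lengthSpan k V m)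
    (hg : g ∈ lengthSpan k V n) : f * g ∈ lengthSpan k V (m + n) := by
  refine Submodule.mul_le.1 ?_ f hf g hg
  rw [lengthSpan, lengthSpan, Submodule.span_mul_span, Submodule.span_le]
  rintro _ ⟨_, ⟨⟨a, b, p⟩, hp, rfl⟩, _, ⟨⟨b', c, q⟩, hq, rfl⟩, rfl⟩
  by_cases h : b = b'
  · subst h
    change SpanAlg.of _ * SpanAlg.of _ ∈ _
    rw [SpanAlg.of_mul_of_comp]
    apply of_mem_lengthSpan
    change m + n ≤ (p.comp q).length
    rw [Quiver.Path.length_comp]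
    exact Nat.add_le_add hp hq
  · change SpanAlg.of _ * SpanAlg.of _ ∈ _
    rw [SpanAlg.of_mul_of_ne (by exact h)]
    exact Submodule.zero_mem _

variable (k V) in
/-- The span of the paths of length at least `n`, as an ideal. -/
def lengthIdeal (n : ℕ) : Ideal (PathAlgebra k V) :=
  { lengthSpan k V n with
    smul_mem' := fun f g hg => by
      have := mul_mem_lengthSpan (mem_lengthSpan_zero f) hg
      rwa [zero_add] at this }

theorem mem_lengthIdeal {n : ℕ} {f : PathAlgebra k V} :
    f ∈ lengthIdeal k V n ↔ f ∈ lengthSpan k V n := Iff.rfl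

instance (n : ℕ) : (lengthIdeal k V n).IsTwoSided :=
  ⟨fun {f} g hf => by
    have h := mul_mem_lengthSpan (mem_lengthIdeal.1 hf) (mem_lengthSpan_zero g)
    rw [add_zero] at h
    exact mem_lengthIdeal.2 h⟩

theorem arrowIdeal_pow_le (n : ℕ) : arrowIdeal k V ^ n ≤ lengthIdeal k V n := by
  induction n with
  | zero => exact fun f _ => mem_lengthSpan_zero f
  | succ n ih =>
    rw [Submodule.pow_succ]
    refine Ideal.mul_le.2 fun f hf g hg => mul_mem_lengthSpan (ih hf) ?_
    have h : arrowIdeal k V ≤ lengthIdeal k V 1 := by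
      refine idealSpan_le ?_
      rintro _ ⟨a, b, e, rfl⟩
      exact of_mem_lengthSpan le_rfl
    exact h hg

theorem lengthIdeal_eq_bot {n : ℕ} (h : ∀ p : PathOf V, p.hom.length < n) :
    lengthIdeal k V n = ⊥ := by
  rw [eq_bot_iff]
  intro f hf
  rw [mem_lengthIdeal, lengthSpan] at hf
  have : {p : PathOf V | n ≤ p.hom.length} = ∅ := by
    ext p; simp [h p]
  rw [this, Set.image_empty, Submodule.span_empty] at hf
  simpa using hf

theorem arrow_mem_arrowIdeal {a b : V} (e : a ⟶ b) :
    SpanAlg.of ⟨a, b, e.toPath⟩ ∈ arrowIdeal k V :=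
  subset_idealSpan _ ⟨a, b, e, rfl⟩

theorem of_mem_arrowIdeal_sq {p : PathOf V} (h : 2 ≤ p.hom.length) :
    SpanAlg.of p ∈ arrowIdeal k V ^ 2 := by
  obtain ⟨a, b, p⟩ := p
  rcases p with _ | ⟨_ | ⟨p, e⟩, e'⟩
  · simp at h
  · simp at h
  · rw [PathAlgebra.of_cons, PathAlgebra.of_cons, Submodule.pow_succ, Submodule.pow_one]
    exact Ideal.mul_mem_mul (Ideal.mul_mem_left _ _ (arrow_mem_arrowIdeal e))
      (arrow_mem_arrowIdeal e')

theorem IsRelation.mem_arrowIdeal_sq {ρ : PathAlgebra k V} (h : IsRelation ρ) :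
    ρ ∈ arrowIdeal k V ^ 2 := by
  obtain ⟨a, b, h⟩ := h
  rw [SpanAlg.eq_sum ρ]
  exact Submodule.sum_mem _ fun p hp =>
    Submodule.smul_of_tower_mem _ _ (of_mem_arrowIdeal_sq (h p hp).2.2)

instance : (arrowIdeal k V).IsTwoSided := inferInstanceAs ((idealSpan _).IsTwoSided)

theorem Acyclic.length_lt (h : Acyclic V) {a b : V} (p : Quiver.Path a b) :
    p.length < Nat.card V := by
  obtain ⟨S, hS, -⟩ := h.exists_finset p
  have := Fintype.ofFinite V
  rw [Nat.card_eq_fintype_card]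
  have := S.card_le_univ
  omega

/-- Over a finite acyclic quiver each set of relations generates an admissible ideal. -/
theorem Acyclic.admissible (h : Acyclic V) {S : Set (PathAlgebra k V)}
    (hS : ∀ ρ ∈ S, IsRelation ρ) : Admissible (idealSpan S) := by
  -- Paths are shorter than the number of vertices, so this power of the arrow ideal is zero; the
  -- summand `2` secures `2 ≤ n`.
  refine ⟨Nat.card V + 2, Nat.le_add_left _ _, ?_, ?_⟩
  · refine (arrowIdeal_pow_le _).trans ?_
    rw [lengthIdeal_eq_bot fun p => (h.length_lt p.hom).trans (by omega)]
    exact bot_le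
  · exact idealSpan_le fun ρ hρ => (hS ρ hρ).mem_arrowIdeal_sq

end Length

/-! ## The quotient quiver and its paths -/

section Quotient

variable {V : Type u} [Quiver.{v} V] {r : Setoid V} (z : Labelling r)

theorem cls_eq_iff {x y : V} : cls r x = cls r y ↔ r x y :=
  Quotient.eq (r := redSetoid r)

theorem cls_surjective (c : RedQuot r) : ∃ x : V, cls r x = c := Quotient.exists_rep c

/-- The arrow between given vertices over a given arrow of the quotient quiver. -/
def Labelling.lift {i j : RedQuot r} (β : i ⟶ j) (x : FullSub r i) (y : FullSub r j) :
    x.1 ⟶ y.1 :=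
  ((z.bijective x.1 y.1).surjective (Quiver.Hom.cast x.2.symm y.2.symm β)).choose.1

theorem Labelling.lift_not (z : Labelling r) {i j : RedQuot r} (β : i ⟶ j) (x : FullSub r i) (y : FullSub r j) :
    ¬ r x.1 y.1 := by
  exact ((z.bijective x.1 y.1).surjective (Quiver.Hom.cast x.2.symm y.2.symm β)).choose.2

theorem Labelling.map_lift {x y : V} (β : cls r x ⟶ cls r y) (h : ¬ r x y) :
    z.map (x := x) (y := y) ⟨z.lift β ⟨x, rfl⟩ ⟨y, rfl⟩, h⟩ = β :=
  ((z.bijective x y).surjective β).choose_spec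

theorem Labelling.lift_map {x y : V} (e : x ⟶ y) (h : ¬ r x y) :
    z.lift (z.map (x := x) (y := y) ⟨e, h⟩) ⟨x, rfl⟩ ⟨y, rfl⟩ = e := by
  have := (z.bijective x y).injective (z.map_lift (z.map (x := x) (y := y) ⟨e, h⟩) h)
  exact congrArg Subtype.val this

/-- Arrows of the quotient lift between arbitrary representatives, so a path can be lifted arrow by
arrow from any start, with a free choice of the vertex at each step. -/
theorem Labelling.exists_path (z : Labelling r) {i j : RedQuot r} (p : Quiver.Path i j) {a : V} (ha : cls r a = i) :
    ∃ b : V, cls r b = j ∧ Nonempty (Quiver.Path a b) := by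
  induction p with
  | nil => exact ⟨a, ha, ⟨.nil⟩⟩
  | @cons j l p β ih =>
    obtain ⟨b, hb, ⟨q⟩⟩ := ih
    obtain ⟨c, hc⟩ := cls_surjective l
    exact ⟨c, hc, ⟨q.cons (z.lift β ⟨b, hb⟩ ⟨c, hc⟩)⟩⟩

/-- All of a cycle but its last arrow is lifted from `a` to some `b`. The last arrow is then lifted
so as to end at `a`, which closes an oriented cycle of `Q` through an arrow between inequivalent
vertices. -/
theorem Labelling.acyclic (z : Labelling r) (hr : Coherent r) : Acyclic (RedQuot r) := by
  intro i p
  cases p with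
  | nil => rfl
  | @cons j _ p β =>
    obtain ⟨a, ha⟩ := cls_surjective i
    obtain ⟨b, hb, ⟨q⟩⟩ := z.exists_path p ha
    exact absurd (hr.cycle .nil (z.lift β ⟨b, hb⟩ ⟨a, ha⟩) q) (z.lift_not β ⟨b, hb⟩ ⟨a, ha⟩)

/-- Formulated with bundled ends, so that the cast in `Labelling.path` disappears. -/
theorem Labelling.mor_cons_of_rel {a b c : V} (p : Quiver.Path a b) (e : b ⟶ c) (h : r b c) :
    z.mor ⟨a, c, p.cons e⟩ = z.mor ⟨a, b, p⟩ := by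
  have key : ∀ {i j j' : RedQuot r} (q : Quiver.Path i j) (hj : j = j'),
      (⟨i, j', q.cast rfl hj⟩ : PathOf (RedQuot r)) = ⟨i, j, q⟩ := by
    rintro i j _ q rfl
    rfl
  rw [mor, mor, path, dif_pos h]
  exact key _ _

theorem Labelling.mor_cons_of_not {a b c : V} (p : Quiver.Path a b) (e : b ⟶ c) (h : ¬ r b c) :
    z.mor ⟨a, c, p.cons e⟩ = ⟨cls r a, cls r c, (z.path p).cons (z.map (x := b) (y := c) ⟨e, h⟩)⟩ := by
  rw [mor, path, dif_neg h]

theorem Labelling.mor_length_cons_of_not {a b c : V} (p : Quiver.Path a b) (e : b ⟶ c)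
    (h : ¬ r b c) : (z.mor ⟨a, c, p.cons e⟩).hom.length = (z.mor ⟨a, b, p⟩).hom.length + 1 := by
  rw [mor_cons_of_not z p e h]; rfl

theorem FullSub.rel {c : RedQuot r} (x y : FullSub r c) : r x.1 y.1 :=
  cls_eq_iff.1 (x.2.trans y.2.symm)

theorem Labelling.mor_comp_incl {a : V} {c : RedQuot r} {x y : FullSub r c}
    (p : Quiver.Path a x.1) (γ : Quiver.Path x y) :
    z.mor ⟨a, y.1, p.comp ((FullSub.incl r c).mapPath γ)⟩ = z.mor ⟨a, x.1, p⟩ := by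
  induction γ with
  | nil => rfl
  | @cons y y' γ e ih =>
    rw [← ih]
    exact z.mor_cons_of_rel _ _ (FullSub.rel y y')

/-- A path which induces a path of length zero is contained in a full subquiver of a class. -/
theorem Labelling.exists_mapPath {a b : V} (p : Quiver.Path a b)
    (h : (z.mor ⟨a, b, p⟩).hom.length = 0) {c : RedQuot r} (ha : cls r a = c) :
    ∃ (hb : cls r b = c) (γ : @Quiver.Path (FullSub r c) _ ⟨a, ha⟩ ⟨b, hb⟩),
      (FullSub.incl r c).mapPath γ = p := by
  induction p with
  | nil => exact ⟨ha, .nil, rfl⟩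
  | @cons b d p e ih =>
    by_cases hbd : r b d
    · rw [mor_cons_of_rel z p e hbd] at h
      obtain ⟨hb, γ, rfl⟩ := ih h
      exact ⟨(cls_sound hbd).symm.trans hb, γ.cons (c := ⟨d, _⟩) e,
        rfl⟩
    · rw [mor_length_cons_of_not z p e hbd] at h
      exact absurd h (Nat.succ_ne_zero _)

theorem FullSub.mapPath_injective {c : RedQuot r} {x y : FullSub r c} {p q : Quiver.Path x y}
    (h : (FullSub.incl r c).mapPath p = (FullSub.incl r c).mapPath q) : p = q := by
  induction p with
  | nil =>
    cases q with
    | nil => rfl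
    | cons q e => exact absurd (congrArg Quiver.Path.length h) (by simp)
  | @cons y' _ p e ih =>
    cases q with
    | nil => exact absurd (congrArg Quiver.Path.length h) (by simp)
    | @cons y'' _ q e' =>
      rw [Prefunctor.mapPath_cons, Prefunctor.mapPath_cons] at h
      have h₁ : y' = y'' := Subtype.ext (Quiver.Path.obj_eq_of_cons_eq_cons h)
      subst h₁
      have h₂ := eq_of_heq (Quiver.Path.heq_of_cons_eq_cons h)
      have h₃ : HEq ((FullSub.incl r c).map e) ((FullSub.incl r c).map e') :=
        Quiver.Path.hom_heq_of_cons_eq_cons h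
      have h₃ : e = e' := eq_of_heq h₃
      rw [ih h₂, h₃]

theorem FullSub.length_mapPath {c : RedQuot r} {x y : FullSub r c} (p : Quiver.Path x y) :
    ((FullSub.incl r c).mapPath p).length = p.length := by
  induction p with
  | nil => rfl
  | cons p e ih => exact congrArg (· + 1) ih

/-- The inclusion of the full subquiver of a class, on paths. -/
def FullSub.inclMor (r : Setoid V) (c : RedQuot r) (p : PathOf (FullSub r c)) : PathOf V :=
  ⟨p.src.1, p.tgt.1, (FullSub.incl r c).mapPath p.hom⟩

theorem FullSub.inclMor_injective (c : RedQuot r) : Function.Injective (FullSub.inclMor r c) := by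
  rintro ⟨⟨a, ha⟩, ⟨b, hb⟩, p⟩ ⟨⟨a', ha'⟩, ⟨b', hb'⟩, q⟩ h
  obtain rfl : a = a' := congrArg Mor.src h
  obtain rfl : b = b' := congrArg Mor.tgt h
  have h' : (FullSub.incl r c).mapPath p = (FullSub.incl r c).mapPath q :=
    eq_of_heq (Mor.mk.inj h).2.2
  rw [FullSub.mapPath_injective h']

variable {k : Type w} [Field k]

theorem FullSub.inclLin_of (c : RedQuot r) (p : PathOf (FullSub r c)) :
    FullSub.inclLin k r c (SpanAlg.of p) = SpanAlg.of (FullSub.inclMor r c p) :=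
  SpanAlg.map_of _ _

theorem FullSub.inclLin_injective (c : RedQuot r) :
    Function.Injective (FullSub.inclLin k r c) :=
  SpanAlg.map_injective (FullSub.inclMor_injective c)

theorem internalRelations_finite {R : Set (PathAlgebra k V)} (hR : R.Finite) (c : RedQuot r) :
    (internalRelations r R c).Finite :=
  hR.preimage (FullSub.inclLin_injective c).injOn

theorem FullSub.isRelation_of_inclLin {c : RedQuot r} {ω : PathAlgebra k (FullSub r c)}
    (h : IsRelation (FullSub.inclLin k r c ω)) : IsRelation ω := by
  classical
  -- The zero combination has no path from which to read off the ends; any vertex of the class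
  -- serves.
  by_cases hω : ω.supp = ∅
  · obtain ⟨x, hx⟩ := cls_surjective c
    exact ⟨⟨x, hx⟩, ⟨x, hx⟩, by simp [hω]⟩
  obtain ⟨p₀, hp₀⟩ := Finset.nonempty_iff_ne_empty.2 hω
  obtain ⟨a, b, h⟩ := h
  have hs : ∀ p ∈ ω.supp, FullSub.inclMor r c p ∈ (FullSub.inclLin k r c ω).supp := fun p hp => by
    have e : (FullSub.inclLin k r c ω).supp = ω.supp.image (FullSub.inclMor r c) :=
      SpanAlg.supp_map (FullSub.inclMor r c) ω (FullSub.inclMor_injective c).injOn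
    rw [e]
    exact Finset.mem_image_of_mem _ hp
  refine ⟨p₀.src, p₀.tgt, fun p hp => ⟨Subtype.ext ?_, Subtype.ext ?_, ?_⟩⟩
  · exact (h _ (hs p hp)).1.trans (h _ (hs p₀ hp₀)).1.symm
  · exact (h _ (hs p hp)).2.1.trans (h _ (hs p₀ hp₀)).2.1.symm
  · have := (h _ (hs p hp)).2.2
    change 2 ≤ ((FullSub.incl r c).mapPath p.hom).length at this
    rwa [FullSub.length_mapPath] at this

/-- All paths of the relation start at the same vertex and never leave its class, so they all come
from the same full subquiver. -/
theorem Internal.exists_inclLin {z : Labelling r} {ρ : PathAlgebra k V} (hint : Internal z ρ)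
    (hρ : IsRelation ρ) : ∃ (c : RedQuot r) (ω : PathAlgebra k (FullSub r c)),
      FullSub.inclLin k r c ω = ρ := by
  obtain ⟨a, b, h⟩ := hρ
  have key : ∀ p ∈ ρ.supp, ∃ γ : PathOf (FullSub r (cls r a)), FullSub.inclMor r _ γ = p := by
    rintro ⟨a', b', p⟩ hp
    obtain rfl : a' = a := (h _ hp).1
    obtain ⟨hb, γ, hγ⟩ := z.exists_mapPath p (hint _ hp) rfl
    exact ⟨⟨_, _, γ⟩, congrArg (Mor.mk a' b') hγ⟩
  choose g hg using key
  refine ⟨cls r a, ∑ p ∈ ρ.supp.attach, ρ.coeff p.1 • SpanAlg.of (g p.1 p.2), ?_⟩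
  simp only [map_sum, map_smul, FullSub.inclLin_of, hg]
  rw [Finset.sum_attach ρ.supp fun p => ρ.coeff p • SpanAlg.of p]
  exact (SpanAlg.eq_sum ρ).symm

/-! ## Straightforward paths -/

/-- The first arrow of the path, if there is one, joins vertices which are not equivalent. -/
def StartsAcross (r : Setoid V) {a : V} : ∀ {b : V}, Quiver.Path a b → Prop
  | _, .nil => True
  | _, .cons (b := b) (c := c) p _ => StartsAcross r p ∧ (p.length = 0 → ¬ r b c)

/-- `Straightforward` splits off the first arrow, whereas paths are built by appending a last one.
The recursive form makes the condition on the first arrow accessible to induction. -/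
theorem startsAcross_iff {a b : V} (p : Quiver.Path a b) : StartsAcross r p ↔
    ∀ (c : V) (e : a ⟶ c) (q : Quiver.Path c b), p = e.toPath.comp q → ¬ r a c := by
  constructor
  · rintro h c e q rfl
    induction q with
    | nil => exact h.2 rfl
    | cons q e' ih => exact ih h.1
  · intro h
    induction p with
    | nil => trivial
    | @cons b d p e ih =>
      refine ⟨ih fun c e' q hq => h c e' (q.cons e) (by rw [hq]; rfl), fun hp => ?_⟩
      obtain rfl := Quiver.Path.eq_of_length_zero p hp
      obtain rfl := Quiver.Path.eq_nil_of_length_zero p hp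
      exact h d e .nil rfl

theorem StartsAcross.comp {a b c : V} {p : Quiver.Path a b} (hp : StartsAcross r p)
    (h : 0 < p.length) (q : Quiver.Path b c) : StartsAcross r (p.comp q) := by
  induction q with
  | nil => exact hp
  | cons q e ih =>
    refine ⟨ih, fun h' => ?_⟩
    rw [Quiver.Path.length_comp] at h'
    omega

theorem straightforward_cons_iff {a b c : V} {p : Quiver.Path a b} {e : b ⟶ c} :
    Straightforward r (p.cons e) ↔ StartsAcross r (p.cons e) ∧ ¬ r b c := by
  rw [Straightforward, ← startsAcross_iff]
  refine and_congr_right fun _ => ⟨fun h => h b p e rfl, ?_⟩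
  intro h d q e' hq
  obtain rfl := Quiver.Path.obj_eq_of_cons_eq_cons hq
  exact h

/-- The first and the last arrow join inequivalent vertices, are two different arrows of the path
because its length is at least two, and are both kept by `z`. -/
theorem Labelling.two_le_length {p : PathOf V} (h : Straightforward r p.hom)
    (hp : 2 ≤ p.hom.length) : 2 ≤ (z.mor p).hom.length := by
  have key : ∀ {a b : V} (p : Quiver.Path a b), StartsAcross r p → 1 ≤ p.length →
      1 ≤ (z.mor ⟨a, b, p⟩).hom.length := by
    intro a b p h hp
    induction p with
    | nil => simp at hp
    | @cons b c p e ih =>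
      by_cases hbc : r b c
      · rw [mor_cons_of_rel z p e hbc]
        exact ih h.1 (Nat.pos_of_ne_zero fun h0 => h.2 h0 hbc)
      · rw [mor_length_cons_of_not z p e hbc]
        omega
  obtain ⟨a, b, p⟩ := p
  cases p with
  | nil => simp at hp
  | cons p e =>
    obtain ⟨h₁, h₂⟩ := straightforward_cons_iff.1 h
    rw [mor_length_cons_of_not z p e h₂]
    have := key p h₁.1 (by simpa using hp)
    omega

theorem External.injOn {z : Labelling r} {ρ : PathAlgebra k V} (h : External z ρ) :
    Set.InjOn z.mor ρ.supp := fun p hp q hq he => by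
  by_contra hne
  exact h.2 p hp q hq hne he

theorem External.isRelation_map {z : Labelling r} {ρ : PathAlgebra k V} (h : External z ρ)
    (hρ : IsRelation ρ) : IsRelation (SpanAlg.map z.mor ρ) := by
  classical
  obtain ⟨a, b, hρ⟩ := hρ
  refine ⟨cls r a, cls r b, fun p hp => ?_⟩
  rw [SpanAlg.supp_map _ _ h.injOn, Finset.mem_image] at hp
  obtain ⟨q, hq, rfl⟩ := hp
  obtain ⟨h₁, h₂, h₃⟩ := hρ q hq
  exact ⟨congrArg (cls r) h₁, congrArg (cls r) h₂, z.two_le_length (h.1 q hq) h₃⟩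

theorem externalRelations_isRelation {z : Labelling r} {R : Set (PathAlgebra k V)}
    (hR : ∀ ρ ∈ R, IsRelation ρ) : ∀ ρ ∈ externalRelations z R, IsRelation ρ := by
  rintro _ ⟨ρ, ⟨hρ, he⟩, rfl⟩
  exact he.isRelation_map (hR ρ hρ)

variable [Finite V]

theorem assocGbp_isGbp (hfin : ∀ x y : V, Finite (x ⟶ y)) {R : Set (PathAlgebra k V)}
    (hRfin : R.Finite) (hRrel : ∀ ρ ∈ R, IsRelation ρ) (hr : Coherent r) {z : Labelling r}
    (hz : Compatible z R) : (assocGbp z R).IsGbp where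
  finite_arrows _ _ := inferInstanceAs (Finite (Fin _))
  finite_fiber_arrows _ x y := hfin x.1 y.1
  finite_Ω i := internalRelations_finite hRfin i
  relation_Ω _ _ hω := FullSub.isRelation_of_inclLin (hRrel _ hω)
  admissible_Ω := hz.admissible
  finite_I := (hRfin.subset fun _ h => h.1).image _
  relation_I := externalRelations_isRelation hRrel
  -- Over the acyclic quotient quiver, being a set of relations is enough.
  admissible_I := (z.acyclic hr).admissible (externalRelations_isRelation hRrel)

end Quotient

/-! ### Canonical representations and the universal property of `k(Γ, 𝒜, I)` -/

theorem quotient_linearMap_ext {k A N : Type*} [Field k] [Ring A] [Algebra k A] [AddCommGroup N]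
    [Module k N] {I : Ideal A} [I.IsTwoSided] {φ ψ : (A ⧸ I) →ₗ[k] N}
    (h : φ ∘ₗ (Ideal.Quotient.mkₐ k I).toLinearMap =
      ψ ∘ₗ (Ideal.Quotient.mkₐ k I).toLinearMap) : φ = ψ := by
  refine LinearMap.ext fun x => ?_
  obtain ⟨y, rfl⟩ := Ideal.Quotient.mk_surjective x
  exact LinearMap.congr_fun h y

theorem algHom_sum_smul {k A B ι : Type*} [Field k] [Ring A] [Algebra k A] [Ring B] [Algebra k B]
    (φ : A →ₐ[k] B) (s : Finset ι) (c : ι → k) (f : ι → A) :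
    φ (∑ i ∈ s, c i • f i) = ∑ i ∈ s, c i • φ (f i) := by
  simp only [map_sum, map_smul]

namespace APathRep

variable {k : Type w} [Field k] {Γ : Type u} [Quiver.{v} Γ] [Fintype Γ]
  {A : Γ → Type u'} [∀ i, Ring (A i)] [∀ i, Algebra k (A i)] {C : Type w'} [Ring C]
  [Algebra k C]

/-- The composition of a representation with a homomorphism of algebras. -/
def map {C' : Type*} [Ring C'] [Algebra k C'] (P : APathRep k A C) (φ : C →ₐ[k] C') :
    APathRep k A C' where
  entry i := φ.toLinearMap ∘ₗ P.entry i
  arrow β := φ (P.arrow β)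
  entry_mul i x y := by simp [P.entry_mul]
  entry_mul_ne i j x y h := by
    simp only [LinearMap.comp_apply, AlgHom.toLinearMap_apply, ← map_mul, P.entry_mul_ne i j x y h,
      map_zero]
  sum_entry_one := by
    simp only [LinearMap.comp_apply, AlgHom.toLinearMap_apply, ← map_sum, P.sum_entry_one, map_one]
  one_mul_arrow β := by
    simp only [LinearMap.comp_apply, AlgHom.toLinearMap_apply, ← map_mul, P.one_mul_arrow]
  arrow_mul_one β := by
    simp only [LinearMap.comp_apply, AlgHom.toLinearMap_apply, ← map_mul, P.arrow_mul_one]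

theorem map_val {C' : Type*} [Ring C'] [Algebra k C'] (P : APathRep k A C) (φ : C →ₐ[k] C')
    {i j : Γ} (p : APath A i j) : (P.map φ).val p = φ (P.val p) := by
  induction p with
  | nil x => rfl
  | cons p β x ih => rw [val, val, map_mul, map_mul, ih]; rfl

end APathRep

namespace GPA

variable (k : Type w) [Field k] {Γ : Type u} [Quiver.{v} Γ] [Fintype Γ]
  (A : Γ → Type u') [∀ i, Ring (A i)] [∀ i, Algebra k (A i)]

/-- The canonical representation in the generalized path algebra. -/
def rep : APathRep k A (GPA k A) where
  entry := entry k A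
  arrow β := GPA.of k (.cons (.nil 1) β 1)
  entry_mul i x y := (of_mul_of (.nil x) (.nil y)).symm
  entry_mul_ne i j x y h := of_mul_of_ne (.nil x) (.nil y) h
  sum_entry_one := one_eq_sum.symm
  one_mul_arrow β := (of_mul_of (.nil 1) (.cons (.nil 1) β 1)).trans
    (by rw [APath.one_comp])
  arrow_mul_one β := (of_mul_of (.cons (.nil 1) β 1) (.nil 1)).trans
    (by rw [APath.comp, APath.mulLast_one])

theorem rep_val {i j : Γ} (p : APath A i j) : (rep k A).val p = GPA.of k p := by
  induction p with
  | nil x => rfl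
  | @cons j l p β x ih =>
    rw [APathRep.val, ih]
    refine (congrArg (· * GPA.of k (APath.nil x)) (of_mul_of p (.cons (.nil 1) β 1))).trans ?_
    rw [of_mul_of]
    simp only [APath.comp, APath.mulLast_one]
    simp only [APath.mulLast, one_mul]

end GPA

namespace GbpData

variable {k : Type w} [Field k] {Γ : Type u} [Quiver.{v} Γ] (D : GbpData.{u, v, w, u', v'} k Γ)

theorem pathClass_mul {i : Γ} {a b c : D.fiber i} (p : Quiver.Path a b) (q : Quiver.Path b c) :
    D.pathClass ⟨a, b, p⟩ * D.pathClass ⟨b, c, q⟩ = D.pathClass ⟨a, c, p.comp q⟩ := by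
  rw [pathClass, pathClass, ← map_mul, SpanAlg.of_mul_of_comp]; rfl

theorem pathClass_mul_ne {i : Γ} {p q : PathOf (D.fiber i)} (h : p.tgt ≠ q.src) :
    D.pathClass p * D.pathClass q = 0 := by
  rw [pathClass, pathClass, ← map_mul, SpanAlg.of_mul_of_ne h, map_zero]

theorem sum_pathClass_nil (i : Γ) [Fintype (D.fiber i)] :
    ∑ x : D.fiber i, D.pathClass ⟨x, x, .nil⟩ = 1 := by
  simp only [pathClass]
  rw [← map_sum, ← map_one (Ideal.Quotient.mk (idealSpan (D.Ω i)))]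
  congr 1
  exact SpanAlg.one_eq_sum.symm

theorem vertexAlg_linearMap_ext {i : Γ} {N : Type*} [AddCommGroup N] [Module k N]
    {φ ψ : D.vertexAlg i →ₗ[k] N} (h : ∀ γ, φ (D.pathClass γ) = ψ (D.pathClass γ)) :
    φ = ψ :=
  quotient_linearMap_ext (SpanAlg.linearMap_ext h)

/-- The canonical representation in `k(Γ, 𝒜, I)`. -/
def algRep [Fintype Γ] : APathRep k D.vertexAlg D.Alg :=
  (GPA.rep k D.vertexAlg).map (Ideal.Quotient.mkₐ k (idealSpan D.insertedRelations))

theorem algRep_val [Fintype Γ] {i j : Γ} (p : APath D.vertexAlg i j) :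
    D.algRep.val p = Ideal.Quotient.mk (idealSpan D.insertedRelations) (GPA.of k p) := by
  rw [algRep, APathRep.map_val, GPA.rep_val]; rfl

/-- The sums which are obtained from the elements of `I` by insertions vanish in `C`. -/
def Annihilates [Fintype Γ] {C : Type*} [Ring C] [Algebra k C]
    (P : APathRep k D.vertexAlg C) : Prop :=
  ∀ ρ ∈ D.I, ∀ f : ∀ β : PathOf Γ, APath D.vertexAlg β.src β.tgt,
    (∀ β ∈ ρ.supp, D.Insertion β.hom (f β)) → ∑ β ∈ ρ.supp, ρ.coeff β • P.val (f β) = 0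

theorem annihilates_algRep [Fintype Γ] : D.Annihilates D.algRep := by
  intro ρ hρ f hf
  have h : (∑ β ∈ ρ.supp, ρ.coeff β • GPA.of k (f β)) ∈ idealSpan D.insertedRelations :=
    subset_idealSpan _ ⟨ρ, hρ, f, hf, rfl⟩
  have h' : Ideal.Quotient.mkₐ k (idealSpan D.insertedRelations)
      (∑ β ∈ ρ.supp, ρ.coeff β • GPA.of k (f β)) = 0 := Ideal.Quotient.eq_zero_iff_mem.2 h
  refine Eq.trans ?_ h'
  refine Eq.trans (Finset.sum_congr rfl fun β _ => ?_) (algHom_sum_smul _ _ _ _).symm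
  rw [algRep_val]; rfl

variable {D} in
/-- The homomorphism from `k(Γ, 𝒜, I)` defined by a representation. -/
def lift [Fintype Γ] {C : Type*} [Ring C] [Algebra k C] {P : APathRep k D.vertexAlg C}
    (hP : D.Annihilates P) : D.Alg →ₐ[k] C :=
  Ideal.Quotient.liftₐ (idealSpan D.insertedRelations) P.gpaHom fun _ hx =>
    eq_zero_of_mem_idealSpan P.gpaHom (by
      rintro _ ⟨ρ, hρ, f, hf, rfl⟩
      rw [algHom_sum_smul, ← hP ρ hρ f hf]
      exact Finset.sum_congr rfl fun β _ => by rw [P.gpaHom_of]) hx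

variable {D} in
theorem lift_val [Fintype Γ] {C : Type*} [Ring C] [Algebra k C] {P : APathRep k D.vertexAlg C}
    (hP : D.Annihilates P) {i j : Γ} (p : APath D.vertexAlg i j) :
    lift hP (D.algRep.val p) = P.val p := by
  rw [algRep_val]
  exact P.gpaHom_of p

-- The algebra is generated by the arrows and the vertex algebras, and each vertex algebra is
-- spanned by the classes of paths.
variable {D} in
theorem alg_hom_ext [Fintype Γ] {C : Type*} [Ring C] [Algebra k C] {φ ψ : D.Alg →ₐ[k] C}
    (entry : ∀ (i) (γ : PathOf (D.fiber i)), φ (D.algRep.entry i (D.pathClass γ)) =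
      ψ (D.algRep.entry i (D.pathClass γ)))
    (arrow : ∀ {i j : Γ} (β : i ⟶ j), φ (D.algRep.arrow β) = ψ (D.algRep.arrow β)) : φ = ψ := by
  have h₁ : ∀ i (x : D.vertexAlg i), φ (D.algRep.entry i x) = ψ (D.algRep.entry i x) := by
    intro i
    exact LinearMap.congr_fun (D.vertexAlg_linearMap_ext
      (φ := φ.toLinearMap ∘ₗ D.algRep.entry i) (ψ := ψ.toLinearMap ∘ₗ D.algRep.entry i) (entry i))
  apply Ideal.Quotient.algHom_ext
  exact GPA.algHom_ext (φ := φ.comp (Ideal.Quotient.mkₐ k (idealSpan D.insertedRelations)))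
    (ψ := ψ.comp (Ideal.Quotient.mkₐ k (idealSpan D.insertedRelations))) h₁ arrow

end GbpData

/-- Supplies default values: a choice of insertions is a function on all paths of `Γ`, although only
those in the support of a relation matter. -/
theorem exists_aPath {Γ : Type u} [Quiver.{v} Γ] (A : Γ → Type w) [∀ i, Ring (A i)] {i j : Γ}
    (p : Quiver.Path i j) : Nonempty (APath A i j) := by
  induction p with
  | nil => exact ⟨.nil 1⟩
  | cons p e ih => exact ⟨.cons ih.some e 1⟩

/-! ### The homomorphism from `kQ/(R)` given by a representation of the generalized path algebra -/

section Forward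

variable {k : Type w} [Field k] {V : Type u} [Quiver.{v} V] [Fintype V] {r : Setoid V}
  [Fintype (RedQuot r)] (z : Labelling r) (R : Set (PathAlgebra k V)) {C : Type w'} [Ring C]
  [Algebra k C] (P : APathRep k (assocGbp z R).vertexAlg C)

/-- The element of `C` given by a path inside of a class. -/
def innerPath (c : RedQuot r) {x y : FullSub r c} (γ : Quiver.Path x y) : C :=
  P.entry c ((assocGbp z R).pathClass (i := c) ⟨x, y, γ⟩)

theorem innerPath_mul (c : RedQuot r) {x y y' : FullSub r c} (γ : Quiver.Path x y)
    (δ : Quiver.Path y y') :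
    innerPath z R P c γ * innerPath z R P c δ = innerPath z R P c (γ.comp δ) :=
  (P.entry_mul c _ _).symm.trans
    (congrArg (P.entry c) ((assocGbp z R).pathClass_mul γ δ))

/-- The idempotent of `C` at a vertex of `Q`. -/
def vertexIdem (a : V) : C := innerPath z R P (cls r a) (x := ⟨a, rfl⟩) .nil

/-- Allows the class of a vertex to be any `c` equal to it, which keeps transports along equalities
of classes out of later computations. -/
theorem vertexIdem_eq {c : RedQuot r} (x : FullSub r c) :
    vertexIdem z R P x.1 = innerPath z R P c (x := x) .nil := by
  obtain ⟨x, rfl⟩ := x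
  rfl

theorem innerPath_mul_vertexIdem (c : RedQuot r) {x y : FullSub r c} (γ : Quiver.Path x y) :
    innerPath z R P c γ * vertexIdem z R P y.1 = innerPath z R P c γ := by
  rw [vertexIdem_eq, innerPath_mul]; rfl

theorem vertexIdem_mul_innerPath (c : RedQuot r) {x y : FullSub r c} (γ : Quiver.Path x y) :
    vertexIdem z R P x.1 * innerPath z R P c γ = innerPath z R P c γ := by
  rw [vertexIdem_eq, innerPath_mul, Quiver.Path.nil_comp]

theorem vertexIdem_mul_self (a : V) :
    vertexIdem z R P a * vertexIdem z R P a = vertexIdem z R P a :=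
  innerPath_mul_vertexIdem z R P (cls r a) (y := ⟨a, rfl⟩) .nil

theorem vertexIdem_mul_ne {a b : V} (h : a ≠ b) :
    vertexIdem z R P a * vertexIdem z R P b = 0 := by
  by_cases hab : cls r a = cls r b
  · have hb := vertexIdem_eq z R P (c := cls r a) ⟨b, hab.symm⟩
    have hne : (⟨a, rfl⟩ : FullSub r (cls r a)) ≠ ⟨b, hab.symm⟩ :=
      fun he => h (congrArg Subtype.val he)
    refine (congrArg (vertexIdem z R P a * ·) hb).trans ((P.entry_mul (cls r a) _ _).symm.trans ?_)
    exact (congrArg (P.entry (cls r a)) ((assocGbp z R).pathClass_mul_ne hne)).trans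
      (P.entry (cls r a)).map_zero
  · exact P.entry_mul_ne _ _ _ _ hab

theorem sum_fullSub {M : Type*} [AddCommMonoid M] (f : V → M)
    [∀ c, Fintype (FullSub r c)] : ∑ c : RedQuot r, ∑ x : FullSub r c, f x.1 = ∑ a : V, f a := by
  classical
  refine (Finset.sum_congr rfl fun c _ => ?_).trans (Fintype.sum_fiberwise (cls r) f)
  let e : FullSub r c ≃ {x : V // cls r x = c} :=
    ⟨fun x => x, fun x => x, fun _ => rfl, fun _ => rfl⟩
  exact Fintype.sum_equiv e _ _ fun _ => rfl

theorem sum_vertexIdem_fullSub (c : RedQuot r) [Fintype (FullSub r c)] :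
    ∑ x : FullSub r c, vertexIdem z R P x.1 = P.entry c 1 := by
  have h := congrArg (P.entry c) (@GbpData.sum_pathClass_nil _ _ _ _
    (assocGbp z R) c (inferInstanceAs (Fintype (FullSub r c))))
  exact (Finset.sum_congr rfl fun x _ => vertexIdem_eq z R P x).trans
    ((map_sum (P.entry c) _ _).symm.trans h)

theorem sum_vertexIdem : ∑ a, vertexIdem z R P a = 1 := by
  have := fun c : RedQuot r => Fintype.ofFinite (FullSub r c)
  rw [← sum_fullSub (r := r), ← P.sum_entry_one]
  exact Finset.sum_congr rfl fun c _ => sum_vertexIdem_fullSub z R P c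

open Classical in
/-- The representation of `Q` in `C`. -/
def toAssoc : PathRep V C where
  idem := vertexIdem z R P
  arrow {a b} e :=
    if h : r a b then
      innerPath z R P (cls r a) (x := ⟨a, rfl⟩) (y := ⟨b, (cls_sound h).symm⟩) (Quiver.Hom.toPath e)
    else vertexIdem z R P a * P.arrow (z.map (x := a) (y := b) ⟨e, h⟩) * vertexIdem z R P b
  idem_mul_self := vertexIdem_mul_self z R P
  idem_mul_ne _ _ h := vertexIdem_mul_ne z R P h
  sum_idem := sum_vertexIdem z R P
  idem_mul_arrow {a b} e := by
    split_ifs with h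
    · exact vertexIdem_mul_innerPath z R P (cls r a) (x := ⟨a, rfl⟩) _
    · rw [← mul_assoc, ← mul_assoc, vertexIdem_mul_self]
  arrow_mul_idem {a b} e := by
    split_ifs with h
    · exact innerPath_mul_vertexIdem z R P (cls r a) (y := ⟨b, (cls_sound h).symm⟩) _
    · rw [mul_assoc, vertexIdem_mul_self]

theorem toAssoc_arrow_of_not {a b : V} (e : a ⟶ b) (h : ¬ r a b) : (toAssoc z R P).arrow e =
    vertexIdem z R P a * P.arrow (z.map (x := a) (y := b) ⟨e, h⟩) * vertexIdem z R P b :=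
  dif_neg h

theorem toAssoc_arrow_fullSub {c : RedQuot r} {x y : FullSub r c} (e : x ⟶ y) :
    (toAssoc z R P).arrow (show x.1 ⟶ y.1 from e) = innerPath z R P c e.toPath := by
  obtain ⟨x, rfl⟩ := x
  exact dif_pos (cls_eq_iff.1 y.2.symm)

theorem toAssoc_val_mapPath {c : RedQuot r} {x y : FullSub r c} (γ : Quiver.Path x y) :
    (toAssoc z R P).val ((FullSub.incl r c).mapPath γ) = innerPath z R P c γ := by
  induction γ with
  | nil => exact vertexIdem_eq z R P x
  | cons γ e ih =>
    rw [Prefunctor.mapPath_cons, PathRep.val, ih]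
    exact (congrArg (_ * ·) (toAssoc_arrow_fullSub z R P e)).trans (innerPath_mul z R P c γ e.toPath)

/-- On the path algebra of a full subquiver the homomorphism factors through `A_c`, which is why
internal relations are killed. -/
theorem toAssoc_inclLin {c : RedQuot r} (ω : PathAlgebra k (FullSub r c)) :
    (toAssoc z R P).algHom (FullSub.inclLin k r c ω) =
      P.entry c (Ideal.Quotient.mk (idealSpan (internalRelations r R c)) ω) := by
  have h : ((toAssoc z R P).algHom (k := k)).toLinearMap ∘ₗ FullSub.inclLin k r c =
      P.entry c ∘ₗ
        (Ideal.Quotient.mkₐ k (idealSpan (internalRelations r R c))).toLinearMap := by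
    apply SpanAlg.linearMap_ext
    intro p
    rw [LinearMap.comp_apply, FullSub.inclLin_of, AlgHom.toLinearMap_apply, PathRep.algHom_of]
    exact toAssoc_val_mapPath z R P p.hom
  exact LinearMap.congr_fun h ω

theorem toAssoc_internal {ρ : PathAlgebra k V} (hR : ρ ∈ R) (hint : Internal z ρ)
    (hρ : IsRelation ρ) : (toAssoc z R P).algHom ρ = 0 := by
  obtain ⟨c, ω, rfl⟩ := hint.exists_inclLin hρ
  rw [toAssoc_inclLin]
  have h : Ideal.Quotient.mk (idealSpan (internalRelations r R c)) ω = 0 :=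
    Ideal.Quotient.eq_zero_iff_mem.2 (subset_idealSpan _ hR)
  exact (congrArg (P.entry c) h).trans (P.entry c).map_zero

/-- The value at the path `p` of the representation of `Q` in `C` is `e_a f γ`, where `f` arises
from the induced path by insertions. -/
def Factors {a b : V} (p : Quiver.Path a b) : Prop :=
  ∃ (j : RedQuot r) (hb : cls r b = j) (q : Quiver.Path (cls r a) j)
    (f : APath (assocGbp z R).vertexAlg (cls r a) j) (x : FullSub r j)
    (γ : Quiver.Path x ⟨b, hb⟩), (assocGbp z R).Insertion q f ∧
      z.mor ⟨a, b, p⟩ = ⟨cls r a, j, q⟩ ∧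
      (toAssoc z R P).val p = vertexIdem z R P a * P.val f * innerPath z R P j γ

/-- An arrow between classes completes an insertion: the inner path `γ` left over at the end of `p`
becomes the inserted path in front of the new arrow. The factorization of `p` is required in
positive length only, since an insertion contains at least one arrow. -/
theorem exists_insertion_cons {a b c : V} (p : Quiver.Path a b) (e : b ⟶ c) (h : ¬ r b c)
    (hp : 0 < p.length → Factors z R P p) :
    ∃ f : APath (assocGbp z R).vertexAlg (cls r a) (cls r c),
      (assocGbp z R).Insertion (z.path (p.cons e)) f ∧
      (toAssoc z R P).val (p.cons e) =
        vertexIdem z R P a * P.val f * vertexIdem z R P c := by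
  have hz : z.path (p.cons e) = (z.path p).cons (z.map (x := b) (y := c) ⟨e, h⟩) := by
    rw [Labelling.path, dif_neg h]
  rw [hz, PathRep.val, toAssoc_arrow_of_not z R P e h]
  -- If `p` is trivial, the new arrow is the first one and nothing is inserted before it.
  rcases Nat.eq_zero_or_pos p.length with h0 | h0
  · obtain rfl := Quiver.Path.eq_of_length_zero p h0
    obtain rfl := Quiver.Path.eq_nil_of_length_zero p h0
    have hn : z.path (.nil : Quiver.Path a a) = .nil := by rw [Labelling.path]
    rw [hn]
    refine ⟨_, GbpData.Insertion.single _, ?_⟩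
    change vertexIdem z R P a * _ = _
    rw [← mul_assoc, ← mul_assoc, vertexIdem_mul_self, APathRep.val, APathRep.val,
      P.one_mul_arrow, P.arrow_mul_one]
  · obtain ⟨j, rfl, q, f, x, γ, hf, hq, hv⟩ := hp h0
    obtain rfl : z.path p = q := eq_of_heq (Mor.mk.inj hq).2.2
    refine ⟨_, GbpData.Insertion.cons hf ⟨x, _, γ⟩ _, ?_⟩
    have h₁ := innerPath_mul_vertexIdem z R P (cls r b) γ
    rw [hv, APathRep.val, APathRep.val_mulLast, mul_assoc (P.val f * _), P.arrow_mul_one]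
    simp only [mul_assoc]
    rw [← mul_assoc (innerPath z R P _ γ), h₁]
    rfl

/-- Reading the path from left to right, an arrow inside a class prolongs the inner path `γ` at the
end, and an arrow between classes absorbs `γ` and starts a trivial one. -/
theorem StartsAcross.factors {a b : V} {p : Quiver.Path a b} (h : StartsAcross r p)
    (hp : 0 < p.length) : Factors z R P p := by
  induction p with
  | nil => simp at hp
  | @cons b c p e ih =>
    by_cases hbc : r b c
    · obtain ⟨j, hb, q, f, x, γ, hf, hq, hv⟩ :=
        ih h.1 (Nat.pos_of_ne_zero fun h0 => h.2 h0 hbc)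
      refine ⟨j, (cls_sound hbc).symm.trans hb, q, f, x, γ.cons (c := ⟨c, _⟩) e, hf,
        (z.mor_cons_of_rel p e hbc).trans hq, ?_⟩
      rw [PathRep.val, hv, mul_assoc]
      congr 1
      exact (congrArg (_ * ·) (toAssoc_arrow_fullSub z R P (x := ⟨b, hb⟩)
        (y := ⟨c, (cls_sound hbc).symm.trans hb⟩) e)).trans (innerPath_mul z R P j γ _)
    · obtain ⟨f, hf, hv⟩ := exists_insertion_cons z R P p e hbc (ih h.1)
      exact ⟨cls r c, rfl, _, f, ⟨c, rfl⟩, .nil, hf, rfl, hv⟩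

/-- Since the last arrow changes the class, no inner path remains at the end except the idempotent
of the end vertex. -/
theorem Straightforward.exists_insertion {p : PathOf V} (h : Straightforward r p.hom)
    (hp : 0 < p.hom.length) :
    ∃ f : APath (assocGbp z R).vertexAlg (z.mor p).src (z.mor p).tgt,
      (assocGbp z R).Insertion (z.mor p).hom f ∧
      (toAssoc z R P).val p.hom =
        vertexIdem z R P p.src * P.val f * vertexIdem z R P p.tgt := by
  obtain ⟨a, b, p⟩ := p
  cases p with
  | nil => simp at hp
  | cons p e =>
    obtain ⟨h₁, h₂⟩ := straightforward_cons_iff.1 h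
    exact exists_insertion_cons z R P p e h₂ (h₁.1.factors z R P)

theorem toAssoc_external {ρ : PathAlgebra k V} (hR : ρ ∈ R) (hext : External z ρ)
    (hρ : IsRelation ρ) (hP : (assocGbp z R).Annihilates P) :
    (toAssoc z R P).algHom ρ = 0 := by
  classical
  obtain ⟨a, b, h⟩ := hρ
  -- Insertions are found for paths of `Q` but must be indexed by paths of `Γ`. This is consistent
  -- because distinct paths of an external relation induce distinct paths.
  have key : ∀ β : PathOf (RedQuot r), ∃ f : APath (assocGbp z R).vertexAlg β.src β.tgt,
      ∀ p ∈ ρ.supp, z.mor p = β → (assocGbp z R).Insertion β.hom f ∧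
        (toAssoc z R P).val p.hom =
          vertexIdem z R P a * P.val f * vertexIdem z R P b := by
    intro β
    by_cases hβ : ∃ p ∈ ρ.supp, z.mor p = β
    · obtain ⟨p, hp, rfl⟩ := hβ
      obtain ⟨rfl, rfl, hl⟩ := h p hp
      obtain ⟨f, hf, hv⟩ := (hext.1 p hp).exists_insertion z R P (by omega)
      refine ⟨f, fun q hq he => ?_⟩
      obtain rfl := hext.injOn hp hq he.symm
      exact ⟨hf, hv⟩
    · exact ⟨(exists_aPath _ β.hom).some, fun p hp he => absurd ⟨p, hp, he⟩ hβ⟩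
  choose f hf using key
  have hs := SpanAlg.supp_map z.mor ρ hext.injOn
  have h0 := hP (SpanAlg.map z.mor ρ) ⟨ρ, ⟨hR, hext⟩, rfl⟩ f (by
      intro β hβ
      rw [hs, Finset.mem_image] at hβ
      obtain ⟨p, hp, rfl⟩ := hβ
      exact (hf _ p hp rfl).1)
  rw [hs, Finset.sum_image hext.injOn] at h0
  calc (toAssoc z R P).algHom ρ
      = ∑ p ∈ ρ.supp, ρ.coeff p • (toAssoc z R P).val p.hom := by
        conv_lhs => rw [SpanAlg.eq_sum ρ]
        simp only [map_sum, map_smul, PathRep.algHom_of]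
    _ = vertexIdem z R P a * (∑ p ∈ ρ.supp, (SpanAlg.map z.mor ρ).coeff (z.mor p) •
          P.val (f (z.mor p))) * vertexIdem z R P b := by
        rw [Finset.mul_sum, Finset.sum_mul]
        refine Finset.sum_congr rfl fun p hp => ?_
        rw [(hf _ p hp rfl).2, SpanAlg.coeff_map z.mor ρ hext.injOn hp, mul_smul_comm,
          smul_mul_assoc]
    _ = 0 := by rw [h0, mul_zero, zero_mul]

/-- The homomorphism from `kQ/(R)` to `C`. -/
def quotientHom (hRrel : ∀ ρ ∈ R, IsRelation ρ) (hz : Compatible z R)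
    (hP : (assocGbp z R).Annihilates P) : (PathAlgebra k V ⧸ idealSpan R) →ₐ[k] C :=
  Ideal.Quotient.liftₐ (idealSpan R) (toAssoc z R P).algHom fun _ hx =>
    eq_zero_of_mem_idealSpan (toAssoc z R P).algHom (fun ρ hρ =>
      (hz.internal_or_external ρ hρ).elim (fun h => toAssoc_internal z R P hρ h (hRrel ρ hρ))
        fun h => toAssoc_external z R P hρ h (hRrel ρ hρ) hP) hx

theorem quotientHom_mk {hRrel : ∀ ρ ∈ R, IsRelation ρ} {hz : Compatible z R}
    {hP : (assocGbp z R).Annihilates P} {a b : V} (p : Quiver.Path a b) :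
    quotientHom z R P hRrel hz hP (Ideal.Quotient.mk (idealSpan R) (SpanAlg.of ⟨a, b, p⟩)) =
      (toAssoc z R P).val p :=
  (toAssoc z R P).algHom_of ⟨a, b, p⟩

end Forward

/-! ### Linear maps on the quotient by a two-sided ideal -/

section QuotientLift

variable {k A N : Type*} [Field k] [Ring A] [Algebra k A] [AddCommGroup N] [Module k N]
  {I : Ideal A} [I.IsTwoSided]

theorem apply_choose_mk {f : A →ₗ[k] N} (h : ∀ x ∈ I, f x = 0) (y : A) :
    f (Ideal.Quotient.mk_surjective (Ideal.Quotient.mk I y)).choose = f y := by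
  have h₁ := (Ideal.Quotient.mk_surjective (Ideal.Quotient.mk I y)).choose_spec
  have h₂ := h _ ((Ideal.Quotient.mk_eq_mk_iff_sub_mem _ _).1 h₁)
  rwa [map_sub, sub_eq_zero] at h₂

/-- A linear map on an algebra which vanishes on a two-sided ideal, as a map on the quotient. -/
def quotientLift (f : A →ₗ[k] N) (h : ∀ x ∈ I, f x = 0) : (A ⧸ I) →ₗ[k] N where
  toFun x := f (Ideal.Quotient.mk_surjective x).choose
  map_add' x y := by
    obtain ⟨x, rfl⟩ := Ideal.Quotient.mk_surjective x
    obtain ⟨y, rfl⟩ := Ideal.Quotient.mk_surjective y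
    rw [apply_choose_mk h, apply_choose_mk h, ← (Ideal.Quotient.mk I).map_add, apply_choose_mk h,
      map_add]
  map_smul' c x := by
    obtain ⟨x, rfl⟩ := Ideal.Quotient.mk_surjective x
    have e : c • Ideal.Quotient.mk I x = Ideal.Quotient.mk I (c • x) :=
      (map_smul (Ideal.Quotient.mkₐ k I) c x).symm
    rw [e, apply_choose_mk h, apply_choose_mk h, map_smul, RingHom.id_apply]

theorem quotientLift_mk (f : A →ₗ[k] N) (h : ∀ x ∈ I, f x = 0) (y : A) :
    quotientLift f h (Ideal.Quotient.mk I y) = f y := apply_choose_mk h y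

end QuotientLift

/-! ### The representation in `kQ/(R)` which defines the homomorphism from `A(∼)` -/

section Backward

variable {k : Type w} [Field k] {V : Type u} [Quiver.{v} V] [Fintype V] {r : Setoid V}

theorem FullSub.inclLin_mul {c : RedQuot r} (f g : PathAlgebra k (FullSub r c)) :
    FullSub.inclLin k r c (f * g) = FullSub.inclLin k r c f * FullSub.inclLin k r c g := by
  induction f using SpanAlg.induction with
  | zero => simp only [zero_mul, map_zero]
  | add f₁ f₂ h₁ h₂ => simp only [add_mul, map_add, h₁, h₂]
  | of x p =>
    induction g using SpanAlg.induction with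
    | zero => simp only [mul_zero, map_zero]
    | add g₁ g₂ h₁ h₂ => simp only [mul_add, map_add, h₁, h₂]
    | of y q =>
      simp only [smul_mul_smul_comm, map_smul, FullSub.inclLin_of]
      congr 1
      obtain ⟨a, b, p⟩ := p
      obtain ⟨b', d, q⟩ := q
      by_cases h : b = b'
      · subst h
        simp only [SpanAlg.of_mul_of_comp, FullSub.inclLin_of, FullSub.inclMor]
        refine Eq.trans ?_ (SpanAlg.of_mul_of_comp _ _).symm
        exact congrArg (fun t => SpanAlg.of (Mor.mk a.1 d.1 t))
          (Prefunctor.mapPath_comp (FullSub.incl r c) p q)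
      · rw [SpanAlg.of_mul_of_ne (by exact h), map_zero, SpanAlg.of_mul_of_ne]
        exact fun h' => h (Subtype.ext h')

/-- The inclusion of the path algebra of the full subquiver of a class, as a homomorphism of
rings without identity. -/
def FullSub.inclHom (k : Type w) [Field k] (r : Setoid V) (c : RedQuot r) :
    PathAlgebra k (FullSub r c) →ₙ+* PathAlgebra k V :=
  { (FullSub.inclLin k r c).toAddMonoidHom with map_mul' := FullSub.inclLin_mul }

variable (R : Set (PathAlgebra k V))

/-- The inclusion is multiplicative but sends the identity to the sum of the idempotents of the
class, so the version for homomorphisms without identity is needed. -/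
theorem FullSub.inclLin_mem {c : RedQuot r} {f : PathAlgebra k (FullSub r c)}
    (hf : f ∈ idealSpan (internalRelations r R c)) : FullSub.inclLin k r c f ∈ idealSpan R :=
  map_mem_of_mem_idealSpan (FullSub.inclHom k r c) (fun _ hω => subset_idealSpan R hω) hf

/-- The class of a path in `kQ/(R)`. -/
def boundPath {a b : V} (p : Quiver.Path a b) : PathAlgebra k V ⧸ idealSpan R :=
  Ideal.Quotient.mk (idealSpan R) (SpanAlg.of ⟨a, b, p⟩)

theorem boundPath_mul {a b c : V} (p : Quiver.Path a b) (q : Quiver.Path b c) :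
    boundPath R p * boundPath R q = boundPath R (p.comp q) := by
  rw [boundPath, boundPath, ← (Ideal.Quotient.mk (idealSpan R)).map_mul, SpanAlg.of_mul_of_comp]
  rfl

theorem boundPath_mul_ne {a b b' c : V} (p : Quiver.Path a b) (q : Quiver.Path b' c)
    (h : b ≠ b') : boundPath R p * boundPath R q = 0 := by
  rw [boundPath, boundPath, ← (Ideal.Quotient.mk (idealSpan R)).map_mul,
    SpanAlg.of_mul_of_ne (by exact h), (Ideal.Quotient.mk (idealSpan R)).map_zero]

/-- Between `x` and `y` the path `q` absorbs the idempotents at its ends, so the product splits as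
`(e_a x e_b) q (e_c y e_d)`. This is the inductive step in evaluating an insertion between two
vertices. -/
theorem nil_mul_mul_nil {a b c d : V} {p : Quiver.Path a b} (q : Quiver.Path b c)
    {p' : Quiver.Path c d} {x y : PathAlgebra k V ⧸ idealSpan R}
    (hx : boundPath R (.nil : Quiver.Path a a) * x * boundPath R (.nil : Quiver.Path b b) =
      boundPath R p)
    (hy : boundPath R (.nil : Quiver.Path c c) * y * boundPath R (.nil : Quiver.Path d d) =
      boundPath R p') :
    boundPath R (.nil : Quiver.Path a a) * (x * boundPath R q * y) *
      boundPath R (.nil : Quiver.Path d d) = boundPath R ((p.comp q).comp p') := by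
  have hq : boundPath R q = boundPath R (.nil : Quiver.Path b b) * boundPath R q *
      boundPath R (.nil : Quiver.Path c c) := by
    rw [boundPath_mul, boundPath_mul, Quiver.Path.nil_comp, Quiver.Path.comp_nil]
  rw [← boundPath_mul, ← boundPath_mul, ← hx, ← hy]
  nth_rw 1 [hq]
  simp only [mul_assoc]

theorem sum_boundPath_nil : ∑ a : V, boundPath R (.nil : Quiver.Path a a) = 1 := by
  refine (map_sum (Ideal.Quotient.mk (idealSpan R)) _ _).symm.trans
    (Eq.trans ?_ (Ideal.Quotient.mk (idealSpan R)).map_one)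
  rw [SpanAlg.one_eq_sum]
  rfl

theorem sum_boundPath_mul {a b : V} (p : Quiver.Path a b) {c : RedQuot r} (h : cls r a = c)
    [Fintype (FullSub r c)] :
    (∑ x : FullSub r c, boundPath R (.nil : Quiver.Path x.1 x.1)) * boundPath R p =
      boundPath R p := by
  rw [Finset.sum_mul, Finset.sum_eq_single (ι := FullSub r c) ⟨a, h⟩]
  · exact (boundPath_mul R .nil p).trans (by rw [Quiver.Path.nil_comp])
  · exact fun x _ hx => boundPath_mul_ne R _ _ fun e => hx (Subtype.ext e)
  · exact fun h => absurd (Finset.mem_univ _) h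

theorem boundPath_mul_sum {a b : V} (p : Quiver.Path a b) {c : RedQuot r} (h : cls r b = c)
    [Fintype (FullSub r c)] :
    boundPath R p * (∑ x : FullSub r c, boundPath R (.nil : Quiver.Path x.1 x.1)) =
      boundPath R p := by
  rw [Finset.mul_sum, Finset.sum_eq_single (ι := FullSub r c) ⟨b, h⟩]
  · exact boundPath_mul R p .nil
  · exact fun x _ hx => boundPath_mul_ne R _ _ fun e => hx (Subtype.ext e.symm)
  · exact fun h => absurd (Finset.mem_univ _) h

/-- The map from the algebra of a class to `kQ/(R)`. -/
def boundEntry (c : RedQuot r) :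
    (PathAlgebra k (FullSub r c) ⧸ idealSpan (internalRelations r R c)) →ₗ[k]
      PathAlgebra k V ⧸ idealSpan R :=
  quotientLift ((Ideal.Quotient.mkₐ k (idealSpan R)).toLinearMap ∘ₗ FullSub.inclLin k r c)
    fun _ hf => Ideal.Quotient.eq_zero_iff_mem.2 (FullSub.inclLin_mem R hf)

theorem boundEntry_mk (c : RedQuot r) (f : PathAlgebra k (FullSub r c)) :
    boundEntry R c (Ideal.Quotient.mk _ f) =
      Ideal.Quotient.mk (idealSpan R) (FullSub.inclLin k r c f) := quotientLift_mk _ _ _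

theorem boundEntry_of (c : RedQuot r) {x y : FullSub r c} (γ : Quiver.Path x y) :
    boundEntry R c (Ideal.Quotient.mk _ (SpanAlg.of ⟨x, y, γ⟩)) =
      boundPath R ((FullSub.incl r c).mapPath γ) := by
  rw [boundEntry_mk, FullSub.inclLin_of]; rfl

theorem boundEntry_mul (c : RedQuot r)
    (x y : PathAlgebra k (FullSub r c) ⧸ idealSpan (internalRelations r R c)) :
    boundEntry R c (x * y) = boundEntry R c x * boundEntry R c y := by
  obtain ⟨x, rfl⟩ := Ideal.Quotient.mk_surjective x
  obtain ⟨y, rfl⟩ := Ideal.Quotient.mk_surjective y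
  rw [← (Ideal.Quotient.mk _).map_mul, boundEntry_mk, boundEntry_mk, boundEntry_mk,
    FullSub.inclLin_mul, (Ideal.Quotient.mk (idealSpan R)).map_mul]

theorem boundEntry_one (c : RedQuot r) [Fintype (FullSub r c)] :
    boundEntry R c 1 = ∑ x : FullSub r c, boundPath R (.nil : Quiver.Path x.1 x.1) := by
  rw [← (Ideal.Quotient.mk (idealSpan (internalRelations r R c))).map_one, boundEntry_mk,
    SpanAlg.one_eq_sum]
  simp only [map_sum, FullSub.inclLin_of]
  rfl

/-- It suffices that the images of the two identities are orthogonal; they are sums of idempotents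
at disjoint sets of vertices. -/
theorem boundEntry_mul_ne {i j : RedQuot r} [Fintype (FullSub r i)] [Fintype (FullSub r j)]
    (h : i ≠ j) (x : PathAlgebra k (FullSub r i) ⧸ idealSpan (internalRelations r R i))
    (y : PathAlgebra k (FullSub r j) ⧸ idealSpan (internalRelations r R j)) :
    boundEntry R i x * boundEntry R j y = 0 := by
  have h₀ : boundEntry R i 1 * boundEntry R j 1 = 0 := by
    rw [boundEntry_one, boundEntry_one, Finset.sum_mul]
    refine Finset.sum_eq_zero fun a _ => ?_
    rw [Finset.mul_sum]
    refine Finset.sum_eq_zero fun b _ => boundPath_mul_ne R _ _ fun e => h ?_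
    rw [← a.2, ← b.2, e]
  rw [← mul_one x, ← one_mul y, boundEntry_mul, boundEntry_mul, mul_assoc,
    ← mul_assoc (boundEntry R i 1), h₀, zero_mul, mul_zero]

variable (z : Labelling r) [∀ c : RedQuot r, Fintype (FullSub r c)]

/-- The sum of the arrows over an arrow of the quotient quiver. -/
def boundArrow {i j : RedQuot r} (β : i ⟶ j) : PathAlgebra k V ⧸ idealSpan R :=
  ∑ x : FullSub r i, ∑ y : FullSub r j, boundPath R (z.lift β x y).toPath

/-- The idempotents select from the double sum the only lift from `x` to `y`. -/
theorem nil_mul_boundArrow_mul_nil {i j : RedQuot r} (β : i ⟶ j) (x : FullSub r i)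
    (y : FullSub r j) : boundPath R (.nil : Quiver.Path x.1 x.1) * boundArrow R z β *
      boundPath R (.nil : Quiver.Path y.1 y.1) = boundPath R (z.lift β x y).toPath := by
  rw [boundArrow, Finset.mul_sum, Finset.sum_mul, Finset.sum_eq_single x]
  · rw [Finset.mul_sum, Finset.sum_mul, Finset.sum_eq_single y]
    · rw [boundPath_mul, boundPath_mul, Quiver.Path.nil_comp, Quiver.Path.comp_nil]
    · intro y' _ h
      rw [mul_assoc, boundPath_mul_ne R _ _ fun e => h (Subtype.ext e), mul_zero]
    · exact fun h => absurd (Finset.mem_univ _) h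
  · intro x' _ h
    rw [Finset.mul_sum, Finset.sum_mul]
    refine Finset.sum_eq_zero fun y' _ => ?_
    rw [boundPath_mul_ne R _ _ fun e => h (Subtype.ext e.symm), zero_mul]
  · exact fun h => absurd (Finset.mem_univ _) h

variable [Fintype (RedQuot r)]

/-- The representation in `kQ/(R)` which defines the homomorphism from `A(∼)`. -/
def boundRep : APathRep k (assocGbp z R).vertexAlg (PathAlgebra k V ⧸ idealSpan R) where
  entry := boundEntry R
  arrow := boundArrow R z
  entry_mul := boundEntry_mul R
  entry_mul_ne _ _ x y h := boundEntry_mul_ne R h x y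
  sum_entry_one := by
    refine (Finset.sum_congr rfl fun c _ => boundEntry_one R c).trans ?_
    exact (sum_fullSub (r := r) fun a => boundPath R (.nil : Quiver.Path a a)).trans
      (sum_boundPath_nil R)
  one_mul_arrow {i j} β := by
    refine (congrArg (· * boundArrow R z β) (boundEntry_one R i)).trans ?_
    simp only [boundArrow]
    rw [Finset.mul_sum]
    refine Finset.sum_congr rfl fun x _ => ?_
    rw [Finset.mul_sum]
    exact Finset.sum_congr rfl fun y _ => sum_boundPath_mul R _ x.2
  arrow_mul_one {i j} β := by
    refine (congrArg (boundArrow R z β * ·) (boundEntry_one R j)).trans ?_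
    simp only [boundArrow]
    rw [Finset.sum_mul]
    refine Finset.sum_congr rfl fun x _ => ?_
    rw [Finset.sum_mul]
    exact Finset.sum_congr rfl fun y _ => boundPath_mul_sum R _ y.2

theorem boundRep_entry_pathClass {c : RedQuot r} {x y : FullSub r c} (γ : Quiver.Path x y) :
    (boundRep R z).entry c ((assocGbp z R).pathClass (i := c) ⟨x, y, γ⟩) =
      boundPath R ((FullSub.incl r c).mapPath γ) := boundEntry_of R c γ

theorem nil_mul_val {i j : RedQuot r} (f : APath (assocGbp z R).vertexAlg i j) {a : V}
    (h : cls r a ≠ i) : boundPath R (.nil : Quiver.Path a a) * (boundRep R z).val f = 0 := by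
  have e := boundRep_entry_pathClass R z (c := cls r a) (x := ⟨a, rfl⟩) .nil
  refine (congrArg (· * (boundRep R z).val f) e.symm).trans ?_
  rw [← (boundRep R z).one_mul_val f, ← mul_assoc, (boundRep R z).entry_mul_ne _ _ _ _ h, zero_mul]

theorem val_mul_nil {i j : RedQuot r} (f : APath (assocGbp z R).vertexAlg i j) {b : V}
    (h : cls r b ≠ j) : (boundRep R z).val f * boundPath R (.nil : Quiver.Path b b) = 0 := by
  have e := boundRep_entry_pathClass R z (c := cls r b) (x := ⟨b, rfl⟩) .nil
  refine (congrArg ((boundRep R z).val f * ·) e.symm).trans ?_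
  rw [← (boundRep R z).val_mul_one f, mul_assoc, (boundRep R z).entry_mul_ne _ _ _ _ h.symm,
    mul_zero]

/-- Between given vertices, an insertion into a path of the quotient quiver is represented by a
straightforward path. -/
theorem exists_straightforward {i j : RedQuot r} {q : Quiver.Path i j}
    {f : APath (assocGbp z R).vertexAlg i j} (h : (assocGbp z R).Insertion q f)
    (a : FullSub r i) (b : FullSub r j) :
    ∃ η : Quiver.Path a.1 b.1, Straightforward r η ∧ 0 < η.length ∧
      z.mor ⟨a.1, b.1, η⟩ = ⟨i, j, q⟩ ∧
      boundPath R (.nil : Quiver.Path a.1 a.1) * (boundRep R z).val f *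
        boundPath R (.nil : Quiver.Path b.1 b.1) = boundPath R η := by
  induction h with
  | @single j β =>
    refine ⟨(z.lift β a b).toPath, ?_, Nat.one_pos, ?_, ?_⟩
    · exact straightforward_cons_iff.2 ⟨⟨trivial, fun _ => z.lift_not β a b⟩, z.lift_not β a b⟩
    · obtain ⟨a, rfl⟩ := a
      obtain ⟨b, rfl⟩ := b
      have hn : z.path (.nil : Quiver.Path a a) = .nil := by rw [Labelling.path]
      refine (z.mor_cons_of_not .nil _ (z.lift_not β ⟨a, rfl⟩ ⟨b, rfl⟩)).trans ?_
      rw [hn, z.map_lift]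
      rfl
    · rw [APathRep.val, APathRep.val, (boundRep R z).one_mul_arrow, (boundRep R z).arrow_mul_one]
      exact nil_mul_boundArrow_mul_nil R z β a b
  | @cons j l q f h γ β ih =>
    obtain ⟨x, y, γ⟩ := γ
    -- The path built so far is made to end at the start `x` of the inserted path `γ`, so that `γ`
    -- and the lift of `β` from its end `y` can be appended.
    obtain ⟨η, hη, hl, hq, hv⟩ := ih x
    refine ⟨(η.comp ((FullSub.incl r j).mapPath γ)).cons (z.lift β y b), ?_, Nat.succ_pos _, ?_, ?_⟩
    · refine straightforward_cons_iff.2 ⟨⟨?_, fun _ => z.lift_not β y b⟩, z.lift_not β y b⟩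
      exact ((startsAcross_iff η).2 hη.1).comp hl _
    · have hq' := (z.mor_comp_incl η γ).trans hq
      obtain ⟨a, rfl⟩ := a
      obtain ⟨b, rfl⟩ := b
      obtain ⟨y, rfl⟩ := y
      refine (z.mor_cons_of_not _ _ (z.lift_not β ⟨y, rfl⟩ ⟨b, rfl⟩)).trans ?_
      rw [z.map_lift]
      have := eq_of_heq (Mor.mk.inj hq').2.2
      exact congrArg (fun t => Mor.mk _ _ (Quiver.Path.cons t β)) this
    · rw [APathRep.val, mul_assoc ((boundRep R z).val _), (boundRep R z).arrow_mul_one,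
        APathRep.val_mulLast]
      have e := boundRep_entry_pathClass R z γ
      exact (congrArg (fun t => boundPath R (.nil : Quiver.Path a.1 a.1) *
        ((boundRep R z).val f * t * boundArrow R z β) * boundPath R (.nil : Quiver.Path b.1 b.1))
          e).trans (nil_mul_mul_nil R _ hv (nil_mul_boundArrow_mul_nil R z β y b))

/-- Peirce decomposition: `x` is the sum of all `e_a x e_b`. -/
theorem eq_zero_of_nil_mul_mul_nil {x : PathAlgebra k V ⧸ idealSpan R}
    (h : ∀ a b : V, boundPath R (.nil : Quiver.Path a a) * x *
      boundPath R (.nil : Quiver.Path b b) = 0) : x = 0 := by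
  rw [← one_mul x, ← mul_one (1 * x), ← sum_boundPath_nil R, Finset.mul_sum]
  refine Finset.sum_eq_zero fun b _ => ?_
  rw [Finset.sum_mul, Finset.sum_mul]
  exact Finset.sum_eq_zero fun a _ => h a b

/-- The vanishing is tested on each component `e_a · e_b`. If `a` and `b` lie in the end classes of
the relation, the component is a combination of straightforward paths with the same images under
`z`, which is in `R` by exchange; otherwise every term is zero. -/
theorem annihilates_boundRep (hRrel : ∀ ρ ∈ R, IsRelation ρ) (hz : Compatible z R) :
    (assocGbp z R).Annihilates (boundRep R z) := by
  classical
  rintro _ ⟨ρ, ⟨hρ, hext⟩, rfl⟩ f hf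
  obtain ⟨a₀, b₀, hab⟩ := hRrel ρ hρ
  have hs := SpanAlg.supp_map z.mor ρ hext.injOn
  rw [hs] at hf ⊢
  rw [Finset.sum_image hext.injOn]
  refine eq_zero_of_nil_mul_mul_nil R fun a b => ?_
  have hsum : boundPath R (.nil : Quiver.Path a a) *
      (∑ p ∈ ρ.supp, (SpanAlg.map z.mor ρ).coeff (z.mor p) • (boundRep R z).val (f (z.mor p))) *
        boundPath R (.nil : Quiver.Path b b) =
      ∑ p ∈ ρ.supp, ρ.coeff p • (boundPath R (.nil : Quiver.Path a a) *
        (boundRep R z).val (f (z.mor p)) * boundPath R (.nil : Quiver.Path b b)) := by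
    rw [Finset.mul_sum, Finset.sum_mul]
    refine Finset.sum_congr rfl fun p hp => ?_
    rw [SpanAlg.coeff_map z.mor ρ hext.injOn hp, mul_smul_comm, smul_mul_assoc]
  rw [hsum]
  by_cases h : cls r a = cls r a₀ ∧ cls r b = cls r b₀
  -- Exchange needs a path for every `p`, also outside the support, and there may be no path from
  -- `a` to `b` to use as a default. Hence the choice is made conditional on the existence of such a
  -- path, which any `p₀` in the support provides.
  · have key : ∀ p : PathOf V, ∃ η : Nonempty (Quiver.Path a b) → Quiver.Path a b,
        p ∈ ρ.supp → ∃ hn : Nonempty (Quiver.Path a b), (Straightforward r (η hn) ∧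
          z.mor ⟨a, b, η hn⟩ = z.mor p) ∧
          boundPath R (.nil : Quiver.Path a a) * (boundRep R z).val (f (z.mor p)) *
            boundPath R (.nil : Quiver.Path b b) = boundPath R (η hn) := by
      intro p
      by_cases hp : p ∈ ρ.supp
      · obtain ⟨η, h₁, -, h₂, h₃⟩ := exists_straightforward R z
          (hf _ (Finset.mem_image_of_mem _ hp))
          ⟨a, h.1.trans (congrArg (cls r) (hab p hp).1.symm)⟩
          ⟨b, h.2.trans (congrArg (cls r) (hab p hp).2.1.symm)⟩
        exact ⟨fun _ => η, fun _ => ⟨⟨η⟩, ⟨h₁, h₂⟩, h₃⟩⟩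
      · exact ⟨fun hn => hn.some, fun hp' => absurd hp' hp⟩
    choose η hη using key
    rcases Finset.eq_empty_or_nonempty ρ.supp with h0 | ⟨p₀, hp₀⟩
    · rw [h0, Finset.sum_empty]
    obtain ⟨hn, -⟩ := hη p₀ hp₀
    have hR := hz.exchange ρ hρ hext a b (fun p => η p hn) fun p hp => (hη p hp).2.1
    have h0 : Ideal.Quotient.mkₐ k (idealSpan R)
        (∑ p ∈ ρ.supp, ρ.coeff p • SpanAlg.of ⟨a, b, η p hn⟩) = 0 :=
      Ideal.Quotient.eq_zero_iff_mem.2 (subset_idealSpan R hR)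
    rw [algHom_sum_smul] at h0
    refine Eq.trans (Finset.sum_congr rfl fun p hp => ?_) h0
    rw [(hη p hp).2.2]
    rfl
  · refine Finset.sum_eq_zero fun p hp => ?_
    by_cases ha : cls r a = cls r a₀
    · have e := val_mul_nil R z (f (z.mor p)) (b := b)
        fun hb => h ⟨ha, hb.trans (congrArg (cls r) (hab p hp).2.1)⟩
      rw [mul_assoc, e, mul_zero, smul_zero]
    · have e := nil_mul_val R z (f (z.mor p)) (a := a)
        fun ha' => ha (ha'.trans (congrArg (cls r) (hab p hp).1))
      rw [e, zero_mul, smul_zero]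

end Backward

/-! ### The two homomorphisms are mutually inverse -/

section Inverse

variable {k : Type w} [Field k] {V : Type u} [Quiver.{v} V] [Fintype V] {r : Setoid V}
  [Fintype (RedQuot r)] (z : Labelling r)
  (R : Set (PathAlgebra k V)) {C : Type w'} [Ring C] [Algebra k C]
  (P : APathRep k (assocGbp z R).vertexAlg C)

theorem toAssoc_val_toPath {a b : V} (e : a ⟶ b) :
    (toAssoc z R P).val e.toPath = (toAssoc z R P).arrow e := (toAssoc z R P).idem_mul_arrow e

theorem toAssoc_arrow_lift {i j : RedQuot r} (β : i ⟶ j) (x : FullSub r i) (y : FullSub r j) :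
    (toAssoc z R P).arrow (z.lift β x y) =
      vertexIdem z R P x.1 * P.arrow β * vertexIdem z R P y.1 := by
  obtain ⟨x, rfl⟩ := x
  obtain ⟨y, rfl⟩ := y
  have h := z.lift_not β ⟨x, rfl⟩ ⟨y, rfl⟩
  refine (toAssoc_arrow_of_not z R P _ h).trans ?_
  rw [z.map_lift]

variable [∀ c : RedQuot r, Fintype (FullSub r c)]

/-- The sum of the lifts of `β` goes to the sum of all `e_x β e_y`, which is `1_i β 1_j = β`. -/
theorem hom_boundArrow {φ : (PathAlgebra k V ⧸ idealSpan R) →ₐ[k] C}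
    (hφ : ∀ {a b : V} (p : Quiver.Path a b), φ (boundPath R p) = (toAssoc z R P).val p)
    {i j : RedQuot r} (β : i ⟶ j) : φ (boundArrow R z β) = P.arrow β := by
  have h : ∀ (x : FullSub r i) (y : FullSub r j), φ (boundPath R (z.lift β x y).toPath) =
      vertexIdem z R P x.1 * P.arrow β * vertexIdem z R P y.1 := fun x y => by
    rw [hφ, toAssoc_val_toPath, toAssoc_arrow_lift]
  have e : P.arrow β = (∑ x : FullSub r i, vertexIdem z R P x.1) * P.arrow β *
      ∑ y : FullSub r j, vertexIdem z R P y.1 := by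
    rw [sum_vertexIdem_fullSub, sum_vertexIdem_fullSub, P.one_mul_arrow, P.arrow_mul_one]
  rw [e, Finset.sum_mul, Finset.sum_mul]
  simp only [boundArrow, map_sum, h]
  exact Finset.sum_congr rfl fun x _ => (Finset.mul_sum _ _ _).symm

theorem hom_toAssoc_val {φ : C →ₐ[k] PathAlgebra k V ⧸ idealSpan R}
    (hentry : ∀ c x, φ (P.entry c x) = (boundRep R z).entry c x)
    (harrow : ∀ {i j : RedQuot r} (β : i ⟶ j), φ (P.arrow β) = boundArrow R z β)
    {a b : V} (p : Quiver.Path a b) : φ ((toAssoc z R P).val p) = boundPath R p := by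
  have hinner : ∀ {c : RedQuot r} {x y : FullSub r c} (γ : Quiver.Path x y),
      φ (innerPath z R P c γ) = boundPath R ((FullSub.incl r c).mapPath γ) := fun γ =>
    (hentry _ _).trans (boundRep_entry_pathClass R z γ)
  have hidem : ∀ a : V, φ (vertexIdem z R P a) = boundPath R (.nil : Quiver.Path a a) :=
    fun a => hinner _
  induction p with
  | nil => exact hidem a
  | @cons b c p e ih =>
    have he : φ ((toAssoc z R P).arrow e) = boundPath R e.toPath := by
      by_cases h : r b c
      · exact (congrArg φ (toAssoc_arrow_fullSub z R P (x := ⟨b, rfl⟩)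
          (y := ⟨c, (cls_sound h).symm⟩) e)).trans (hinner _)
      -- Here `e_b z(e) e_c` goes to the lift of `z(e)` from `b` to `c`, and this is `e` by
      -- injectivity of the labelling.
      · rw [toAssoc_arrow_of_not z R P e h, map_mul, map_mul, hidem, hidem, harrow]
        refine (nil_mul_boundArrow_mul_nil R z _ ⟨b, rfl⟩ ⟨c, rfl⟩).trans ?_
        rw [z.lift_map]
    rw [PathRep.val, map_mul, ih, he, boundPath_mul]
    rfl

end Inverse

/-- The isomorphism between `kQ/(R)` and `A(∼)`. -/
theorem nonempty_algEquiv {k : Type w} [Field k] {V : Type u} [Quiver.{v} V] [Finite V]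
    {R : Set (PathAlgebra k V)} (hRrel : ∀ ρ ∈ R, IsRelation ρ) {r : Setoid V}
    {z : Labelling r} (hz : Compatible z R) :
    Nonempty ((PathAlgebra k V ⧸ idealSpan R) ≃ₐ[k] (assocGbp z R).Alg) := by
  have := Fintype.ofFinite V
  have := Fintype.ofFinite (RedQuot r)
  have := fun c : RedQuot r => Fintype.ofFinite (FullSub r c)
  let P := (assocGbp z R).algRep
  let Φ := quotientHom z R P hRrel hz (assocGbp z R).annihilates_algRep
  let Ψ := GbpData.lift (annihilates_boundRep R z hRrel hz)
  have hΦ : ∀ {a b : V} (p : Quiver.Path a b), Φ (boundPath R p) = (toAssoc z R P).val p :=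
    fun p => quotientHom_mk z R P p
  have hΨe : ∀ c x, Ψ (P.entry c x) = (boundRep R z).entry c x := fun c x =>
    GbpData.lift_val (annihilates_boundRep R z hRrel hz) (.nil x)
  have hΨa : ∀ {i j : RedQuot r} (β : i ⟶ j), Ψ (P.arrow β) = boundArrow R z β := by
    intro i j β
    have h := GbpData.lift_val (annihilates_boundRep R z hRrel hz)
      (.cons (.nil 1) β 1)
    -- The value at the `𝒜`-path `1 β 1` is reduced to the value at `β` on both sides.
    rw [APathRep.val, APathRep.val, APathRep.val, APathRep.val, APathRep.one_mul_arrow,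
      APathRep.arrow_mul_one, APathRep.one_mul_arrow, APathRep.arrow_mul_one] at h
    exact h
  refine ⟨AlgEquiv.ofAlgHom Φ Ψ ?_ ?_⟩
  · refine GbpData.alg_hom_ext (fun c γ => ?_) fun β => ?_
    · exact (congrArg Φ ((hΨe c _).trans (boundRep_entry_pathClass R z γ.hom))).trans
        ((hΦ _).trans (toAssoc_val_mapPath z R P γ.hom))
    · exact (congrArg Φ (hΨa β)).trans (hom_boundArrow z R P hΦ β)
  · apply Ideal.Quotient.algHom_ext
    apply SpanAlg.algHom_ext
    rintro ⟨a, b, p⟩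
    exact (congrArg Ψ (hΦ p)).trans (hom_toAssoc_val z R P hΨe hΨa p)

end

end GenPathAlg

theorem mainTheorem2 {k : Type*} [Field k] {V : Type*} [Quiver V] [Finite V]
    (hfin : ∀ x y : V, Finite (x ⟶ y))
    (R : Set (PathAlgebra k V)) (hRfin : R.Finite) (hRrel : ∀ ρ ∈ R, IsRelation ρ)
    (hRadm : Admissible (idealSpan R))
    (r : Setoid V) (hr : Coherent r) (z : Labelling r) (hz : Compatible z R) :
    (assocGbp z R).IsSimplificationWithoutCycles (PathAlgebra k V ⧸ idealSpan R) :=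
  ⟨⟨assocGbp_isGbp hfin hRfin hRrel hr hz, nonempty_algEquiv hRrel hz⟩, z.acyclic hr⟩
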